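/- **Syntax.** Fix a vocabulary of predicate symbols and function symbols, each with an arity $k\ge 0$, and an infinite set of object symbols (which serve as constants and as variables). Terms are built from object symbols and function symbols. FO-formulas are built from the atoms $\top,\bot,t=s,P(\bar t)$ by $\lnot,\land,\lor,\Rightarrow,\Leftrightarrow,\forall,\exists$; formulas are identified up to renaming of bound object symbols, and substitution is capture-avoiding. A *definition* $\Phi$ is a finite set of rules $\forall\bar x: P(\bar t)\leftarrow\varphi$ with $\varphi$ an FO-formula. FO(ID)-formulas are built like FO-formulas, with definitions as additional atomic expressions. $\mathrm{Def}(\Phi)$ is the set of predicate symbols in the heads of the rules of $\Phi$, $\mathrm{Par}(\Phi)$ the set of the other predicate symbols occurring in $\Phi$. Positive and negative occurrences of predicate symbols in $\varphi$ are defined as usual ($\varphi\Leftrightarrow\psi$ being read as $(\varphi\Rightarrow\psi)\land(\psi\Rightarrow\varphi)$). $\Phi$ is *stratified* if there is $\ell:\mathrm{Def}(\Phi)\to\mathbb N$ such that for each rule $\forall\bar x:P(\bar t)\leftarrow\varphi$ of $\Phi$ and each $Q\in\mathrm{Def}(\Phi)$: $\ell(Q)\le\ell(P)$ if $Q$ occurs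 in $\varphi$, and $\ell(Q)<\ell(P)$ if $Q$ occurs negatively in $\varphi$. A *sequent* is a pair $\Gamma\vdash\Delta$ of sets of FO(ID)-formulas. Let $\Gamma,\Delta$ be sets of FO-formulas and $\Phi_1,\dots,\Phi_n$ ($n\ge 0$) definitions. The sequent $\Gamma,\Phi_1,\dots,\Phi_n\vdash\Delta$ is *canonical* if $\Gamma,\Delta$ are finite and for all $i,j$: (i) the body of each rule of $\Phi_i$ is composed of literals (atoms and negated atoms) by $\land$ and $\lor$; (ii) $\mathrm{Def}(\Phi_i)\cap\mathrm{Def}(\Phi_j)=\emptyset$ if $i\ne j$; (iii) $\mathrm{Def}(\Phi_i)\cap\mathrm{Par}(\Phi_j)=\emptyset$ if $j<i$. **Henkin semantics.** A structure $I$ has a non-empty domain $D$ and interprets all symbols. A *Henkin class* for $I$ is a family $(H_k)_{k\in\mathbb N}$ of sets $H_k$ of subsets of $D^k$ such that (i) $\{(a,a):a\in D\}\in H_2$; (ii) $Q^I\in H_k$ for every $k$-ary predicate symbol $Q$; (iii) if $R\in H_{k+1}$ and $a\in D$, then $\{\bar b\in D^k:(\bar b,a)\in R\}\in H_k$; (iv)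 if $R\in H_k$, $t_1,\dots,t_k$ are terms in the distinct object symbols $\bar x=x_1,\dots,x_n$ and $\bar y=y_1,\dots,y_m$, and $\bar b\in D^m$, then $\{\bar a\in D^n:(t_1,\dots,t_k)^{I[\bar x:\bar a,\bar y:\bar b]}\in R\}\in H_n$; (v) each $H_k$ is closed under complement and (vi) under binary intersection; (vii) if $R\in H_{k+1}$, then $\{\bar b\in D^k:\forall a\in D\ (\bar b,a)\in R\}\in H_k$. For structures $J,J'$ that agree with $I$ except possibly on $\mathrm{Def}(\Phi)$, let $\mathcal C(J,J')$ be the structure that interprets each $P\in\mathrm{Def}(\Phi)$ by the set of values of $\bar t$, for the rules $\forall\bar x:P(\bar t)\leftarrow\varphi$ of $\Phi$ and values of $\bar x$ such that $\varphi$ is true when positive occurrences of predicate symbols are interpreted by $J$ and negative ones by $J'$. $(I,H)$ satisfies $\Phi$ if $I$ is the least (for inclusion on the defined predicates) among the structures $J$ that agree with $I$ except possibly on $\mathrm{Def}(\Phi)$, satisfy $P^J\in H_k$ for every $P\in\mathrm{Def}(\Phi)$ of arity $k$, and satisfy $P^{\mathcal C(J,I)}\subseteq P^J$ for every $P\in\mathrm{Def}(\Phi)$.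 Satisfaction of other formulas in $(I,H)$ follows the usual Tarskian clauses. A sequent is *valid under the Henkin semantics* if every $(I,H)$ that satisfies all formulas of its left side satisfies some formula of its right side. **Sequent calculus.** It has the following rules. $\Gamma,\varphi$ means $\Gamma\cup\{\varphi\}$, so contraction is implicit. * *Structural:* (ax) $\Gamma\vdash\Delta$ if $\Gamma\cap\Delta\neq\emptyset$ or $\bot\in\Gamma$ or $\top\in\Delta$; (wk) from $\Gamma'\vdash\Delta'$ infer $\Gamma\vdash\Delta$ if $\Gamma'\subseteq\Gamma$, $\Delta'\subseteq\Delta$; (subst) from $\Gamma\vdash\Delta$ infer $\Gamma[t/x]\vdash\Delta[t/x]$; (cut) from $\Gamma\vdash\varphi,\Delta$ and $\Gamma,\varphi\vdash\Delta$ infer $\Gamma\vdash\Delta$, with cut formula $\varphi$. * *Logical:* the usual left and right introduction rules of classical logic for $\lnot,\land,\lor,\Rightarrow,\Leftrightarrow,\forall,\exists$. * *Equality:* from $\Gamma[s/x,t/y]\vdash\Delta[s/x,t/y]$ infer $\Gamma[t/x,s/y],t=s\vdash\Delta[t/x,s/y]$ ($x\ne y$); and $\Gamma\vdash t=t,\Delta$.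 * (def R): for a rule $\forall\bar x:P(\bar t)\leftarrow\varphi$ of $\Phi$ and a tuple of terms $\bar s$, from $\Gamma,\Phi\vdash\varphi[\bar s/\bar x],\Delta$ infer $\Gamma,\Phi\vdash P(\bar t[\bar s/\bar x]),\Delta$. * (def L): let $P\in\Pi\subseteq\mathrm{Def}(\Phi)$ and, for each $Q\in\Pi$, let $F_Q[\bar z]$ be an FO-formula with a tuple $\bar z$ of distinct object symbols, as many as the arity of $Q$. From the major premise $\Gamma,\Phi,F_P[\bar v]\vdash\Delta$ and the minor premises $\Gamma,\Phi,\psi[F_\Pi/\Pi^+]\vdash F_Q[\bar s],\Delta$, one for each rule $\forall\bar y:Q(\bar s)\leftarrow\psi$ of $\Phi$ with $Q\in\Pi$, infer $\Gamma,\Phi,P(\bar v)\vdash\Delta$. Here $\psi[F_\Pi/\Pi^+]$ replaces in $\psi$ each positive occurrence of an atom $R(\bar u)$ with $R\in\Pi$ by $F_R[\bar u]$, and the rule variables $\bar y$ are renamed to distinct object symbols that are not free in $\Gamma$, $\Delta$, $\Phi$, and are not free in any $\forall\bar z:F_R$, $R\in\Pi$. A canonical sequent $\Gamma,\Phi_1,\dots,\Phi_n\vdash\Delta$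 is *provable with elementary cuts* if it has a proof in this calculus in which every cut formula is of the form $\forall\bar y:Q(\bar y)\lor\lnot Q(\bar y)$, where $Q$ is a predicate symbol that occurs negatively in the body of a rule of some $\Phi_i$. **Theorem.** Let $\Gamma,\Phi_1,\dots,\Phi_n\vdash\Delta$ be a canonical sequent such that the definitions $\Phi_1,\dots,\Phi_n$ are stratified. If $\Gamma,\Phi_1,\dots,\Phi_n\vdash\Delta$ is valid under the Henkin semantics, then it is provable with elementary cuts. -/

import Mathlib

universe u

namespace FOID

/-!
Symbols.  The vocabulary consists of a first-order language `L` (predicate and function symbols)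
and a type `Ob` of object symbols.  Object symbols occur free in formulas; bound occurrences are
represented by indices in `Fin n`, so formulas and rules are identified up to renaming of bound
object symbols and all substitutions are capture-avoiding.
-/

/-- A predicate symbol together with its arity. -/
abbrev Pred (L : FirstOrder.Language.{u, u}) : Type u := Σ k : ℕ, L.Relations k

/-- Terms over the object symbols `Ob` and `n` bound variables. -/
abbrev Tm (L : FirstOrder.Language.{u, u}) (Ob : Type u) (n : ℕ) : Type u := L.Term (Ob ⊕ Fin n)

/-- Formulas with `n` bound variables in scope, built from the atoms `⊤`, `⊥`, `t = s`, `P(t₁,…,tₖ)`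
and from additional atomic expressions in `A`. -/
inductive Fml (L : FirstOrder.Language.{u, u}) (Ob : Type u) (A : ℕ → Type u) : ℕ → Type u
  | ext {n : ℕ} (a : A n) : Fml L Ob A n
  | top {n : ℕ} : Fml L Ob A n
  | bot {n : ℕ} : Fml L Ob A n
  | eq {n : ℕ} (t s : Tm L Ob n) : Fml L Ob A n
  | rel {n k : ℕ} (R : L.Relations k) (ts : Fin k → Tm L Ob n) : Fml L Ob A n
  | neg {n : ℕ} (φ : Fml L Ob A n) : Fml L Ob A n
  | and {n : ℕ} (φ ψ : Fml L Ob A n) : Fml L Ob A n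
  | or {n : ℕ} (φ ψ : Fml L Ob A n) : Fml L Ob A n
  | imp {n : ℕ} (φ ψ : Fml L Ob A n) : Fml L Ob A n
  | iff {n : ℕ} (φ ψ : Fml L Ob A n) : Fml L Ob A n
  | all {n : ℕ} (φ : Fml L Ob A (n + 1)) : Fml L Ob A n
  | ex {n : ℕ} (φ : Fml L Ob A (n + 1)) : Fml L Ob A n

/-- FO-formulas: no additional atomic expressions. -/
abbrev FO (L : FirstOrder.Language.{u, u}) (Ob : Type u) (n : ℕ) : Type u :=
  Fml L Ob (fun _ => PEmpty.{u + 1}) n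

/-- A definitional rule `∀ x₁ … x_nv : pred(head) ← body`; the rule variables are the last `nv`
of the `n + nv` bound variables. -/
structure Rule (L : FirstOrder.Language.{u, u}) (Ob : Type u) (n : ℕ) : Type u where
  nv : ℕ
  pred : Pred L
  head : Fin pred.1 → Tm L Ob (n + nv)
  body : FO L Ob (n + nv)

/-- A definition: a finite set of definitional rules. -/
abbrev Defn (L : FirstOrder.Language.{u, u}) (Ob : Type u) (n : ℕ) : Type u := Finset (Rule L Ob n)

/-- FO(ID)-formulas: definitions are additional atomic expressions. -/
abbrev FOIDFml (L : FirstOrder.Language.{u, u}) (Ob : Type u) (n : ℕ) : Type u := Fml L Ob (Defn L Ob) n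

section Expressions

variable {L : FirstOrder.Language.{u, u}} {Ob : Type u} {A : ℕ → Type u}

/-- The object symbol `x` as a term. -/
abbrev ob {n : ℕ} (x : Ob) : Tm L Ob n := .var (.inl x)

/-- The bound variable `i` as a term. -/
abbrev bv {n : ℕ} (i : Fin n) : Tm L Ob n := .var (.inr i)

/-- Simultaneous substitutions for object symbols and bound variables. -/
abbrev Sub (L : FirstOrder.Language.{u, u}) (Ob : Type u) (n m : ℕ) : Type u := Ob ⊕ Fin n → Tm L Ob m

/-- A substitution passing under one binder. -/
def Sub.lift {n m : ℕ} (θ : Sub L Ob n m) : Sub L Ob (n + 1) (m + 1) :=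
  let wk : Tm L Ob m → Tm L Ob (m + 1) := fun t => t.relabel (Sum.map id Fin.castSucc)
  Sum.elim (fun x => wk (θ (.inl x)))
    (Fin.lastCases (motive := fun _ => Tm L Ob (m + 1)) (bv (Fin.last m))
      (fun i => wk (θ (.inr i))))

/-- A substitution passing under `k` binders. -/
def Sub.liftN {n m : ℕ} (θ : Sub L Ob n m) : (k : ℕ) → Sub L Ob (n + k) (m + k)
  | 0 => θ
  | k + 1 => (θ.liftN k).lift

/-- Replace the last `k` bound variables by the terms `s`. -/
def Sub.inst {n k : ℕ} (s : Fin k → Tm L Ob n) : Sub L Ob (n + k) n :=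
  Sum.elim ob (Fin.append bv s)

/-- Replace the object symbol `x` by the term `t`. -/
noncomputable def Sub.single {n : ℕ} (x : Ob) (t : Tm L Ob n) : Sub L Ob n n :=
  open Classical in Sum.elim (Function.update ob x t) bv

/-- Replace simultaneously the object symbol `x` by `t` and the object symbol `y` by `s`. -/
noncomputable def Sub.double {n : ℕ} (x : Ob) (t : Tm L Ob n) (y : Ob) (s : Tm L Ob n) :
    Sub L Ob n n :=
  open Classical in Sum.elim (Function.update (Function.update ob y s) x t) bv

/-- Substitution in formulas, given substitution in the additional atomic expressions. -/
def Fml.substWith (sA : ∀ {n m : ℕ}, Sub L Ob n m → A n → A m) :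
    ∀ {n m : ℕ}, Sub L Ob n m → Fml L Ob A n → Fml L Ob A m
  | _, _, θ, .ext a => .ext (sA θ a)
  | _, _, _, .top => .top
  | _, _, _, .bot => .bot
  | _, _, θ, .eq t s => .eq (t.subst θ) (s.subst θ)
  | _, _, θ, .rel R ts => .rel R (fun i => (ts i).subst θ)
  | _, _, θ, .neg φ => .neg (φ.substWith sA θ)
  | _, _, θ, .and φ ψ => .and (φ.substWith sA θ) (ψ.substWith sA θ)
  | _, _, θ, .or φ ψ => .or (φ.substWith sA θ) (ψ.substWith sA θ)
  | _, _, θ, .imp φ ψ => .imp (φ.substWith sA θ) (ψ.substWith sA θ)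
  | _, _, θ, .iff φ ψ => .iff (φ.substWith sA θ) (ψ.substWith sA θ)
  | _, _, θ, .all φ => .all (φ.substWith sA θ.lift)
  | _, _, θ, .ex φ => .ex (φ.substWith sA θ.lift)

/-- Substitution in FO-formulas. -/
def FO.subst {n m : ℕ} (θ : Sub L Ob n m) (φ : FO L Ob n) : FO L Ob m :=
  Fml.substWith (fun _ a => a.elim) θ φ

/-- Substitution in definitional rules. -/
def Rule.subst {n m : ℕ} (θ : Sub L Ob n m) (r : Rule L Ob n) : Rule L Ob m where
  nv := r.nv
  pred := r.pred
  head := fun i => (r.head i).subst (θ.liftN r.nv)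
  body := FO.subst (θ.liftN r.nv) r.body

/-- Substitution in definitions. -/
noncomputable def Defn.subst {n m : ℕ} (θ : Sub L Ob n m) (Φ : Defn L Ob n) : Defn L Ob m :=
  open Classical in Finset.image (Rule.subst θ) Φ

/-- Substitution in FO(ID)-formulas. -/
noncomputable def FOIDFml.subst {n m : ℕ} (θ : Sub L Ob n m) (φ : FOIDFml L Ob n) :
    FOIDFml L Ob m :=
  Fml.substWith (fun θ Φ => Defn.subst θ Φ) θ φ

/-- The object symbols occurring in a term. -/
def tmFree {n : ℕ} (t : Tm L Ob n) : Set Ob :=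
  open Classical in {x | x ∈ t.varFinsetLeft}

/-- The freely occurring object symbols of a formula. -/
def Fml.freeWith (fA : ∀ {n : ℕ}, A n → Set Ob) : ∀ {n : ℕ}, Fml L Ob A n → Set Ob
  | _, .ext a => fA a
  | _, .top => ∅
  | _, .bot => ∅
  | _, .eq t s => tmFree t ∪ tmFree s
  | _, .rel _ ts => ⋃ i, tmFree (ts i)
  | _, .neg φ => φ.freeWith fA
  | _, .and φ ψ => φ.freeWith fA ∪ ψ.freeWith fA
  | _, .or φ ψ => φ.freeWith fA ∪ ψ.freeWith fA
  | _, .imp φ ψ => φ.freeWith fA ∪ ψ.freeWith fA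
  | _, .iff φ ψ => φ.freeWith fA ∪ ψ.freeWith fA
  | _, .all φ => φ.freeWith fA
  | _, .ex φ => φ.freeWith fA

/-- The freely occurring object symbols of an FO-formula. -/
def FO.free {n : ℕ} (φ : FO L Ob n) : Set Ob := Fml.freeWith (fun a => a.elim) φ

/-- The freely occurring object symbols of a definition. -/
def Defn.free {n : ℕ} (Φ : Defn L Ob n) : Set Ob :=
  ⋃ r ∈ Φ, (⋃ i, tmFree (r.head i)) ∪ FO.free r.body

/-- The freely occurring object symbols of an FO(ID)-formula. -/
def FOIDFml.free {n : ℕ} (φ : FOIDFml L Ob n) : Set Ob := Fml.freeWith (fun Φ => Defn.free Φ) φ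

/-- FO-formulas are FO(ID)-formulas. -/
def FO.toID : ∀ {n : ℕ}, FO L Ob n → FOIDFml L Ob n
  | _, .ext a => a.elim
  | _, .top => .top
  | _, .bot => .bot
  | _, .eq t s => .eq t s
  | _, .rel R ts => .rel R ts
  | _, .neg φ => .neg (FO.toID φ)
  | _, .and φ ψ => .and (FO.toID φ) (FO.toID ψ)
  | _, .or φ ψ => .or (FO.toID φ) (FO.toID ψ)
  | _, .imp φ ψ => .imp (FO.toID φ) (FO.toID ψ)
  | _, .iff φ ψ => .iff (FO.toID φ) (FO.toID ψ)
  | _, .all φ => .all (FO.toID φ)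
  | _, .ex φ => .ex (FO.toID φ)

/-- `FO.Occurs Q true φ`: the predicate symbol `Q` occurs positively in `φ`;
`FO.Occurs Q false φ`: it occurs negatively.  Both sides of a biconditional occur with both
polarities, since `φ ⇔ ψ` unwinds to `(φ ⇒ ψ) ∧ (ψ ⇒ φ)`. -/
def FO.Occurs (Q : Pred L) : Bool → ∀ {n : ℕ}, FO L Ob n → Prop
  | _, _, .ext a => a.elim
  | _, _, .top => False
  | _, _, .bot => False
  | _, _, .eq _ _ => False
  | b, _, .rel (k := k) R _ => b = true ∧ Q = ⟨k, R⟩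
  | b, _, .neg φ => FO.Occurs Q (!b) φ
  | b, _, .and φ ψ => FO.Occurs Q b φ ∨ FO.Occurs Q b ψ
  | b, _, .or φ ψ => FO.Occurs Q b φ ∨ FO.Occurs Q b ψ
  | b, _, .imp φ ψ => FO.Occurs Q (!b) φ ∨ FO.Occurs Q b ψ
  | b, _, .iff φ ψ => (FO.Occurs Q b φ ∨ FO.Occurs Q (!b) φ) ∨
      (FO.Occurs Q b ψ ∨ FO.Occurs Q (!b) ψ)
  | b, _, .all φ => FO.Occurs Q b φ
  | b, _, .ex φ => FO.Occurs Q b φ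

/-- `FO.replace Π F true ψ` is `ψ[F_Π / Π⁺]`: every positive occurrence of an atom `Q(t)` with
`Q ∈ Π` is replaced by `F_Q[t]`.  `FO.replace Π F false ψ` replaces the negative occurrences.
Biconditionals are unwound, as their two sides occur with both polarities. -/
noncomputable def FO.replace (Pi : Set (Pred L)) (F : ∀ Q : Pred L, FO L Ob Q.1) :
    Bool → ∀ {n : ℕ}, FO L Ob n → FO L Ob n
  | _, _, .ext a => a.elim
  | _, _, .top => .top
  | _, _, .bot => .bot
  | _, _, .eq t s => .eq t s
  | b, _, .rel (k := k) R ts =>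
      open Classical in
      if b = true ∧ (⟨k, R⟩ : Pred L) ∈ Pi then FO.subst (Sum.elim ob ts) (F ⟨k, R⟩)
      else .rel R ts
  | b, _, .neg φ => .neg (FO.replace Pi F (!b) φ)
  | b, _, .and φ ψ => .and (FO.replace Pi F b φ) (FO.replace Pi F b ψ)
  | b, _, .or φ ψ => .or (FO.replace Pi F b φ) (FO.replace Pi F b ψ)
  | b, _, .imp φ ψ => .imp (FO.replace Pi F (!b) φ) (FO.replace Pi F b ψ)
  | b, _, .iff φ ψ => .and (.imp (FO.replace Pi F (!b) φ) (FO.replace Pi F b ψ))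
      (.imp (FO.replace Pi F (!b) ψ) (FO.replace Pi F b φ))
  | b, _, .all φ => .all (FO.replace Pi F b φ)
  | b, _, .ex φ => .ex (FO.replace Pi F b φ)

/-- Atoms `⊤`, `⊥`, `t = s`, `P(t)`. -/
def FO.IsAtom {n : ℕ} : FO L Ob n → Prop
  | .top => True
  | .bot => True
  | .eq _ _ => True
  | .rel _ _ => True
  | _ => False

/-- Literals: atoms and negated atoms. -/
def FO.IsLiteral {n : ℕ} : FO L Ob n → Prop
  | .neg φ => FO.IsAtom φ
  | φ => FO.IsAtom φ

/-- Formulas composed of literals by conjunctions and disjunctions. -/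
inductive FO.IsLitComb {n : ℕ} : FO L Ob n → Prop
  | lit {φ : FO L Ob n} : FO.IsLiteral φ → FO.IsLitComb φ
  | and {φ ψ : FO L Ob n} : FO.IsLitComb φ → FO.IsLitComb ψ → FO.IsLitComb (.and φ ψ)
  | or {φ ψ : FO L Ob n} : FO.IsLitComb φ → FO.IsLitComb ψ → FO.IsLitComb (.or φ ψ)

/-- The defined predicates of a definition. -/
def Defn.defined {n : ℕ} (Φ : Defn L Ob n) : Set (Pred L) := {P | ∃ r ∈ Φ, r.pred = P}

/-- The parameter predicates of a definition: the predicate symbols that occur in it and are not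
defined by it. -/
def Defn.params {n : ℕ} (Φ : Defn L Ob n) : Set (Pred L) :=
  {Q | Q ∉ Φ.defined ∧ ∃ r ∈ Φ, ∃ b : Bool, FO.Occurs Q b r.body}

/-- Stratified definitions. -/
def Defn.Stratified {n : ℕ} (Φ : Defn L Ob n) : Prop :=
  ∃ ℓ : Φ.defined → ℕ, ∀ P Q : Φ.defined, ∀ r ∈ Φ, r.pred = P →
    ((∃ b : Bool, FO.Occurs Q.1 b r.body) → ℓ Q ≤ ℓ P) ∧
    (FO.Occurs Q.1 false r.body → ℓ Q < ℓ P)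

/-- Universal closure `∀ y₁ : … ∀ yₙ : φ` over the bound variables in scope. -/
def Fml.alls : ∀ {n : ℕ}, Fml L Ob A n → Fml L Ob A 0
  | 0, φ => φ
  | _ + 1, φ => Fml.alls (.all φ)

/-- The formula `∀ y₁ … yₖ : Q(y₁,…,yₖ) ∨ ¬ Q(y₁,…,yₖ)`. -/
def excludedMiddle (Q : Pred L) : FO L Ob 0 := Fml.alls (.or (.rel Q.2 bv) (.neg (.rel Q.2 bv)))

end Expressions

section Calculus

variable {L : FirstOrder.Language.{u, u}} {Ob : Type u}

/-- The freely occurring object symbols of a set of formulas. -/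
def setFree (Γ : Set (FOIDFml L Ob 0)) : Set Ob := ⋃ φ ∈ Γ, FOIDFml.free φ

/-- `Provable C Γ Δ`: the sequent `Γ ⊢ Δ` has a proof in the sequent calculus for FO(ID) in which
every cut formula belongs to `C`. -/
inductive Provable (C : Set (FOIDFml L Ob 0)) :
    Set (FOIDFml L Ob 0) → Set (FOIDFml L Ob 0) → Prop
  | ax {Γ Δ} : (Γ ∩ Δ).Nonempty ∨ Fml.bot ∈ Γ ∨ Fml.top ∈ Δ → Provable C Γ Δ
  | wk {Γ Δ Γ' Δ'} : Γ' ⊆ Γ → Δ' ⊆ Δ → Provable C Γ' Δ' → Provable C Γ Δ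
  | subst {Γ Δ} (x : Ob) (t : Tm L Ob 0) : Provable C Γ Δ →
      Provable C (FOIDFml.subst (Sub.single x t) '' Γ) (FOIDFml.subst (Sub.single x t) '' Δ)
  | cut {Γ Δ φ} : φ ∈ C → Provable C Γ (insert φ Δ) → Provable C (insert φ Γ) Δ →
      Provable C Γ Δ
  | negL {Γ Δ φ} : Provable C Γ (insert φ Δ) → Provable C (insert (.neg φ) Γ) Δ
  | negR {Γ Δ φ} : Provable C (insert φ Γ) Δ → Provable C Γ (insert (.neg φ) Δ)
  | orL {Γ Δ φ ψ} : Provable C (insert φ Γ) Δ → Provable C (insert ψ Γ) Δ →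
      Provable C (insert (.or φ ψ) Γ) Δ
  | orR {Γ Δ φ ψ} : Provable C Γ (insert φ (insert ψ Δ)) → Provable C Γ (insert (.or φ ψ) Δ)
  | andL {Γ Δ φ ψ} : Provable C (insert φ (insert ψ Γ)) Δ → Provable C (insert (.and φ ψ) Γ) Δ
  | andR {Γ Δ φ ψ} : Provable C Γ (insert φ Δ) → Provable C Γ (insert ψ Δ) →
      Provable C Γ (insert (.and φ ψ) Δ)
  | impL {Γ Δ φ ψ} : Provable C Γ (insert φ Δ) → Provable C (insert ψ Γ) Δ →
      Provable C (insert (.imp φ ψ) Γ) Δ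
  | impR {Γ Δ φ ψ} : Provable C (insert φ Γ) (insert ψ Δ) → Provable C Γ (insert (.imp φ ψ) Δ)
  | iffL {Γ Δ φ ψ} : Provable C Γ (insert φ (insert ψ Δ)) →
      Provable C (insert φ (insert ψ Γ)) Δ → Provable C (insert (.iff φ ψ) Γ) Δ
  | iffR {Γ Δ φ ψ} : Provable C (insert φ Γ) (insert ψ Δ) →
      Provable C (insert ψ Γ) (insert φ Δ) → Provable C Γ (insert (.iff φ ψ) Δ)
  | allL {Γ Δ} {φ : FOIDFml L Ob 1} (t : Tm L Ob 0) :
      Provable C (insert (FOIDFml.subst (Sub.inst fun _ : Fin 1 => t) φ) Γ) Δ →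
      Provable C (insert (.all φ) Γ) Δ
  | allR {Γ Δ} {φ : FOIDFml L Ob 1} (x : Ob) :
      x ∉ setFree Γ → x ∉ setFree Δ → x ∉ FOIDFml.free φ →
      Provable C Γ (insert (FOIDFml.subst (Sub.inst fun _ : Fin 1 => ob x) φ) Δ) →
      Provable C Γ (insert (.all φ) Δ)
  | exL {Γ Δ} {φ : FOIDFml L Ob 1} (x : Ob) :
      x ∉ setFree Γ → x ∉ setFree Δ → x ∉ FOIDFml.free φ →
      Provable C (insert (FOIDFml.subst (Sub.inst fun _ : Fin 1 => ob x) φ) Γ) Δ →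
      Provable C (insert (.ex φ) Γ) Δ
  | exR {Γ Δ} {φ : FOIDFml L Ob 1} (t : Tm L Ob 0) :
      Provable C Γ (insert (FOIDFml.subst (Sub.inst fun _ : Fin 1 => t) φ) Δ) →
      Provable C Γ (insert (.ex φ) Δ)
  | eqL {Γ Δ} (x y : Ob) (t s : Tm L Ob 0) : x ≠ y →
      Provable C (FOIDFml.subst (Sub.double x s y t) '' Γ)
        (FOIDFml.subst (Sub.double x s y t) '' Δ) →
      Provable C (insert (.eq t s) (FOIDFml.subst (Sub.double x t y s) '' Γ))
        (FOIDFml.subst (Sub.double x t y s) '' Δ)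
  | eqR {Γ Δ} (t : Tm L Ob 0) : Provable C Γ (insert (.eq t t) Δ)
  /-- The right introduction rule for defined atoms. -/
  | defR {Γ Δ} (Φ : Defn L Ob 0) (r : Rule L Ob 0) (s : Fin r.nv → Tm L Ob 0) :
      Fml.ext Φ ∈ Γ → r ∈ Φ →
      Provable C Γ (insert (FO.toID (FO.subst (Sub.inst s) r.body)) Δ) →
      Provable C Γ (insert (.rel r.pred.2 fun i => (r.head i).subst (Sub.inst s)) Δ)
  /-- The left introduction rule for defined atoms (induction rule), for a set `Pi` of defined
  predicates and induction hypotheses `F Q`.  For each rule `r` of `Φ`, `y r` are the object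
  symbols that stand for the rule variables in the minor premise. -/
  | defL {Γ Δ} (Φ : Defn L Ob 0) (Pi : Set (Pred L)) (F : ∀ Q : Pred L, FO L Ob Q.1)
      (y : ∀ r : Rule L Ob 0, Fin r.nv → Ob) (P : Pred L) (v : Fin P.1 → Tm L Ob 0) :
      Fml.ext Φ ∈ Γ → Pi ⊆ Φ.defined → P ∈ Pi →
      (∀ r ∈ Φ, r.pred ∈ Pi → Function.Injective (y r) ∧
        ∀ i, y r i ∉ setFree Γ ∧ y r i ∉ setFree Δ ∧ ∀ Q ∈ Pi, y r i ∉ FO.free (F Q)) →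
      (∀ r ∈ Φ, r.pred ∈ Pi → Provable C
        (insert (FO.toID (FO.replace Pi F true
          (FO.subst (Sub.inst fun i => ob (y r i)) r.body))) Γ)
        (insert (FO.toID (FO.subst
          (Sum.elim ob fun j => (r.head j).subst (Sub.inst fun i => ob (y r i)))
          (F r.pred))) Δ)) →
      Provable C (insert (FO.toID (FO.subst (Sum.elim ob v) (F P))) Γ) Δ →
      Provable C (insert (.rel P.2 v) Γ) Δ

end Calculus

section Semantics

variable {L : FirstOrder.Language.{u, u}} {Ob : Type u} {A : ℕ → Type u} {D : Type u}

/-- An interpretation of all predicate symbols in the domain `D`. -/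
abbrev PredInterp (L : FirstOrder.Language.{u, u}) (D : Type u) : Type u := ∀ P : Pred L, Set (Fin P.1 → D)

/-- The interpretation of the predicate symbols in an `L`-structure. -/
def PredInterp.ofStructure (L : FirstOrder.Language.{u, u}) (D : Type u) [L.Structure D] : PredInterp L D :=
  fun P => {a | FirstOrder.Language.Structure.RelMap P.2 a}

/-- Truth of a formula when the positive occurrences of predicate symbols are interpreted by the
first interpretation and the negative ones by the second.  When both interpretations are equal,
this is the usual (Tarskian) satisfaction.  `v` interprets the object symbols. -/
def Fml.Holds [L.Structure D] (v : Ob → D) (hA : ∀ {n : ℕ}, A n → (Fin n → D) → Prop) :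
    PredInterp L D → PredInterp L D → ∀ {n : ℕ}, Fml L Ob A n → (Fin n → D) → Prop
  | _, _, _, .ext a, e => hA a e
  | _, _, _, .top, _ => True
  | _, _, _, .bot, _ => False
  | _, _, _, .eq t s, e => t.realize (Sum.elim v e) = s.realize (Sum.elim v e)
  | J, _, _, .rel (k := k) R ts, e => (fun i => (ts i).realize (Sum.elim v e)) ∈ J ⟨k, R⟩
  | J, I, _, .neg φ, e => ¬ φ.Holds v hA I J e
  | J, I, _, .and φ ψ, e => φ.Holds v hA J I e ∧ ψ.Holds v hA J I e
  | J, I, _, .or φ ψ, e => φ.Holds v hA J I e ∨ ψ.Holds v hA J I e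
  | J, I, _, .imp φ ψ, e => φ.Holds v hA I J e → ψ.Holds v hA J I e
  | J, I, _, .iff φ ψ, e => (φ.Holds v hA I J e → ψ.Holds v hA J I e) ∧
      (ψ.Holds v hA I J e → φ.Holds v hA J I e)
  | J, I, _, .all φ, e => ∀ a : D, φ.Holds v hA J I (Fin.snoc e a)
  | J, I, _, .ex φ, e => ∃ a : D, φ.Holds v hA J I (Fin.snoc e a)

/-- The operator `𝒞(J, I)` of a definition: `P` holds of `a` if, for some rule with head `P(t)`
and some values `b` of the rule variables, `t` takes the value `a` and the body is true, where
positive occurrences of predicates are interpreted by `J` and negative ones by `I`.  That is,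
the merged body of `P` (the disjunction of the formulas `∃ x : y = t ∧ body`) is true at `a`. -/
def Defn.op [L.Structure D] (v : Ob → D) {n : ℕ} (e : Fin n → D) (Φ : Defn L Ob n)
    (J I : PredInterp L D) : PredInterp L D :=
  fun P => {a | ∃ r ∈ Φ, ∃ b : Fin r.nv → D,
    (⟨r.pred, fun i => (r.head i).realize (Sum.elim v (Fin.append e b))⟩ :
      Σ Q : Pred L, (Fin Q.1 → D)) = ⟨P, a⟩ ∧
    Fml.Holds v (fun x _ => x.elim) J I r.body (Fin.append e b)}

/-- Henkin classes for the structure `D`. -/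
structure IsHenkinClass (L : FirstOrder.Language.{u, u}) (D : Type u) [L.Structure D]
    (H : ∀ k : ℕ, Set (Set (Fin k → D))) : Prop where
  equality : {a : Fin 2 → D | a 0 = a 1} ∈ H 2
  predicate : ∀ P : Pred L, PredInterp.ofStructure L D P ∈ H P.1
  projection : ∀ (k : ℕ) (R : Set (Fin (k + 1) → D)) (a : D), R ∈ H (k + 1) →
    {b : Fin k → D | (Fin.snoc b a : Fin (k + 1) → D) ∈ R} ∈ H k
  terms : ∀ (k n m : ℕ) (R : Set (Fin k → D)) (t : Fin k → L.Term (Fin n ⊕ Fin m))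
    (b : Fin m → D), R ∈ H k →
    {a : Fin n → D | (fun i => (t i).realize (Sum.elim a b)) ∈ R} ∈ H n
  complement : ∀ (k : ℕ) (R : Set (Fin k → D)), R ∈ H k → Rᶜ ∈ H k
  intersection : ∀ (k : ℕ) (R S : Set (Fin k → D)), R ∈ H k → S ∈ H k → R ∩ S ∈ H k
  forall_mem : ∀ (k : ℕ) (R : Set (Fin (k + 1) → D)), R ∈ H (k + 1) →
    {b : Fin k → D | ∀ a : D, (Fin.snoc b a : Fin (k + 1) → D) ∈ R} ∈ H k

/-- The structure is a Henkin model of the definition `Φ`: among the interpretations that differ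
from the one of the structure only on the defined predicates, that interpret these by relations
in `H`, and that are pre-fixed points of `𝒞(·, I)`, its own interpretation `I` is the least. -/
def Defn.HenkinModel [L.Structure D] (H : ∀ k : ℕ, Set (Set (Fin k → D))) (v : Ob → D)
    {n : ℕ} (Φ : Defn L Ob n) (e : Fin n → D) : Prop :=
  IsLeast {J : PredInterp L D |
      (∀ P ∉ Φ.defined, J P = PredInterp.ofStructure L D P) ∧
      (∀ P ∈ Φ.defined, J P ∈ H P.1) ∧
      (∀ P ∈ Φ.defined, Φ.op v e J (PredInterp.ofStructure L D) P ⊆ J P)}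
    (PredInterp.ofStructure L D)

/-- Henkin satisfaction of an FO(ID)-formula. -/
def HenkinSat [L.Structure D] (H : ∀ k : ℕ, Set (Set (Fin k → D))) (v : Ob → D)
    (φ : FOIDFml L Ob 0) : Prop :=
  φ.Holds v (fun Φ e => Defn.HenkinModel H v Φ e) (PredInterp.ofStructure L D)
    (PredInterp.ofStructure L D) Fin.elim0

/-- Validity of the sequent `Γ ⊢ Δ` under the Henkin semantics. -/
def HenkinValid (Γ Δ : Set (FOIDFml L Ob 0)) : Prop :=
  ∀ (D : Type u) [L.Structure D] [Nonempty D] (v : Ob → D) (H : ∀ k : ℕ, Set (Set (Fin k → D))),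
    IsHenkinClass L D H → (∀ φ ∈ Γ, HenkinSat H v φ) → ∃ φ ∈ Δ, HenkinSat H v φ

end Semantics

section Canonical

variable {L : FirstOrder.Language.{u, u}} {Ob : Type u}

/-- The antecedent `Γ, Φ₁, …, Φₙ` of a regular sequent. -/
def antecedent (Γ : Set (FO L Ob 0)) {n : ℕ} (Φ : Fin n → Defn L Ob 0) :
    Set (FOIDFml L Ob 0) :=
  FO.toID '' Γ ∪ Set.range fun i => Fml.ext (Φ i)

/-- The succedent `Δ` of a regular sequent. -/
def succedent (Δ : Set (FO L Ob 0)) : Set (FOIDFml L Ob 0) := FO.toID '' Δ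

/-- The regular sequent `Γ, Φ₁, …, Φₙ ⊢ Δ` is canonical. -/
structure IsCanonical (Γ : Set (FO L Ob 0)) {n : ℕ} (Φ : Fin n → Defn L Ob 0)
    (Δ : Set (FO L Ob 0)) : Prop where
  finite_left : Γ.Finite
  finite_right : Δ.Finite
  body : ∀ i, ∀ r ∈ Φ i, FO.IsLitComb r.body
  disjoint : ∀ i j, i ≠ j → (Φ i).defined ∩ (Φ j).defined = ∅
  order : ∀ i j, j < i → (Φ i).defined ∩ (Φ j).params = ∅

/-- The cut formulas of elementary cuts: `∀ y : Q(y) ∨ ¬ Q(y)` where `Q` occurs negatively in the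
body of a rule of one of the definitions. -/
def elementaryCuts {n : ℕ} (Φ : Fin n → Defn L Ob 0) : Set (FOIDFml L Ob 0) :=
  {χ | ∃ Q : Pred L, (∃ i, ∃ r ∈ Φ i, FO.Occurs Q false r.body) ∧
    χ = FO.toID (excludedMiddle Q)}

/-- `Γ, Φ₁, …, Φₙ ⊢ Δ` is provable with elementary cuts. -/
def ProvableWithElementaryCuts (Γ : Set (FO L Ob 0)) {n : ℕ} (Φ : Fin n → Defn L Ob 0)
    (Δ : Set (FO L Ob 0)) : Prop :=
  Provable (elementaryCuts Φ) (antecedent Γ Φ) (succedent Δ)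

end Canonical

end FOID

/-! The argument is a Henkin completeness proof by contraposition: an unprovable sequent yields a
Henkin countermodel. As only elementary cuts are available, a maximal unprovable sequent need not
decide every formula. Its left side has to come out true and its right side false, while the
undecided atoms leave a gap in which the predicates must be chosen with care.

Only finitely many symbols matter, so the construction takes place in a countable fragment of the
syntax with infinitely many object symbols. There an increasing sequence of finite unprovable
sequents is built (`exists_saturatedChain`) such that each formula of the fragment is, on either
side, eventually present or eventually makes the sequent provable when added. Existential formulas
on the left and universal ones on the right receive witnesses, and every instance of the induction
rule for a full set of defined predicates is answered. Read backwards, each introduction rule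
becomes a closure property of the limit. The domain consists of the terms modulo Leibniz equality:
`t` and `s` are identified if, for every `A`, adding `A(t)` on the right eventually gives provable
sequents exactly when adding `A(s)` does. This is a congruence, and equations on the left become
true and those on the right false, without any cut.

Let `maxPreds` be the largest interpretation that falsifies the atoms on the right. By (def R) it is
closed under the rules. Let `preds` be the least interpretation that contains the atoms on the left
and is closed under the rules of all definitions, with negative occurrences frozen at `maxPreds`.
Freezing makes the operator monotone, so `preds` exists and lies below `maxPreds`; hence the truth
lemma applies to it. Elementary cuts decide the atoms of the predicates that occur negatively in
rule bodies, so `preds` and `maxPreds` agree on these, and `preds` is a pre-fixed point of each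
operator relative to itself.

The Henkin class consists of the relations definable in the resulting model. For leastness, let `J`
be a definable pre-fixed point for one definition. Its defining formulas are legitimate induction
hypotheses for (def L), and the saturation of the chain under that rule forces the atoms on the left
into `J` (`mem_of_rel_left`). So the intersection of `preds` and `J` is again closed, and by
leastness `preds` lies below `J`. Disjointness of the sets of defined predicates enters here: no
rule of another definition can feed a predicate of the one considered. -/

namespace FOID

/-! ### Algebra of substitutions. -/

section Substitution

variable {L : FirstOrder.Language.{u, u}} {Ob : Type u}

/-- The identity substitution. -/
abbrev Sub.ident (n : ℕ) : Sub L Ob n n := Sum.elim ob bv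

/-- Composition of substitutions. -/
def Sub.comp {n m l : ℕ} (θ : Sub L Ob n m) (η : Sub L Ob m l) : Sub L Ob n l :=
  fun z => (θ z).subst η

theorem tm_subst_subst {α β γ : Type u} (t : L.Term α) (f : α → L.Term β) (g : β → L.Term γ) :
    (t.subst f).subst g = t.subst fun z => (f z).subst g := by
  induction t with
  | var => rfl
  | func _ _ ih => simp [FirstOrder.Language.Term.subst, ih]

theorem tm_relabel_eq_subst {α β : Type u} (t : L.Term α) (f : α → β) :
    t.relabel f = t.subst fun z => .var (f z) := by
  induction t with
  | var => rfl
  | func _ _ ih => simp [FirstOrder.Language.Term.subst, FirstOrder.Language.Term.relabel, ih]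

theorem tm_subst_id {n : ℕ} (t : Tm L Ob n) : t.subst (Sub.ident n) = t := by
  induction t with
  | var z => rcases z with z | z <;> rfl
  | func _ _ ih => simp [FirstOrder.Language.Term.subst, ih]

theorem tm_subst_congr {n m : ℕ} {θ η : Sub L Ob n m} (t : Tm L Ob n)
    (h : ∀ x ∈ tmFree t, θ (.inl x) = η (.inl x)) (h' : ∀ i, θ (.inr i) = η (.inr i)) :
    t.subst θ = t.subst η := by
  induction t with
  | var z =>
    rcases z with z | z
    · exact h z (by simp [tmFree, FirstOrder.Language.Term.varFinsetLeft])
    · exact h' z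
  | func f ts ih =>
    simp only [FirstOrder.Language.Term.subst, FirstOrder.Language.Term.func.injEq, heq_eq_eq,
      true_and]
    funext i
    refine ih i fun x hx => h x ?_
    simp only [tmFree, FirstOrder.Language.Term.varFinsetLeft, Set.mem_ofPred_eq,
      Finset.mem_biUnion, Finset.mem_univ, true_and] at hx ⊢
    exact ⟨i, hx⟩

@[simp] theorem Sub.lift_inl {n m : ℕ} (θ : Sub L Ob n m) (x : Ob) :
    θ.lift (.inl x) = (θ (.inl x)).relabel (Sum.map id Fin.castSucc) := rfl

@[simp] theorem Sub.lift_last {n m : ℕ} (θ : Sub L Ob n m) :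
    θ.lift (.inr (Fin.last n)) = bv (Fin.last m) := by
  simp [Sub.lift]

@[simp] theorem Sub.lift_castSucc {n m : ℕ} (θ : Sub L Ob n m) (i : Fin n) :
    θ.lift (.inr i.castSucc) = (θ (.inr i)).relabel (Sum.map id Fin.castSucc) := by
  simp [Sub.lift]

theorem Sub.lift_ext {n m : ℕ} {θ η : Sub L Ob (n + 1) m}
    (h : ∀ x, θ (.inl x) = η (.inl x)) (hl : θ (.inr (Fin.last n)) = η (.inr (Fin.last n)))
    (hc : ∀ i : Fin n, θ (.inr i.castSucc) = η (.inr i.castSucc)) : θ = η := by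
  funext z
  rcases z with x | i
  · exact h x
  · induction i using Fin.lastCases with
    | last => exact hl
    | cast i => exact hc i

theorem tm_relabel_subst_lift {m l : ℕ} (η : Sub L Ob m l) (t : Tm L Ob m) :
    (t.relabel (Sum.map id Fin.castSucc)).subst η.lift =
      (t.subst η).relabel (Sum.map id Fin.castSucc) := by
  rw [tm_relabel_eq_subst, tm_relabel_eq_subst, tm_subst_subst, tm_subst_subst]
  congr 1
  funext z
  rcases z with x | i <;>
    simp [FirstOrder.Language.Term.subst, tm_relabel_eq_subst]

theorem Sub.lift_comp {n m l : ℕ} (θ : Sub L Ob n m) (η : Sub L Ob m l) :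
    (θ.comp η).lift = θ.lift.comp η.lift := by
  apply Sub.lift_ext
  · intro x; simp [Sub.comp, tm_relabel_subst_lift]
  · simp [Sub.comp, FirstOrder.Language.Term.subst]
  · intro i; simp [Sub.comp, tm_relabel_subst_lift]

theorem Sub.lift_id (n : ℕ) : (Sub.ident n : Sub L Ob n n).lift = Sub.ident (n + 1) := by
  apply Sub.lift_ext <;> intros <;> simp [FirstOrder.Language.Term.relabel]

theorem Sub.liftN_id (n k : ℕ) : (Sub.ident n : Sub L Ob n n).liftN k = Sub.ident (n + k) := by
  induction k with
  | zero => rfl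
  | succ k ih => rw [Sub.liftN, ih, Sub.lift_id]; rfl

theorem Sub.lift_congr {n m : ℕ} {S : Set Ob} {θ η : Sub L Ob n m}
    (h : ∀ x ∈ S, θ (.inl x) = η (.inl x)) (h' : ∀ i, θ (.inr i) = η (.inr i)) :
    (∀ x ∈ S, θ.lift (.inl x) = η.lift (.inl x)) ∧ ∀ i, θ.lift (.inr i) = η.lift (.inr i) := by
  refine ⟨fun x hx => by simp [h x hx], fun i => ?_⟩
  induction i using Fin.lastCases with
  | last => simp
  | cast i => simp [h' i]

theorem Sub.liftN_congr {n m : ℕ} {S : Set Ob} {θ η : Sub L Ob n m}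
    (h : ∀ x ∈ S, θ (.inl x) = η (.inl x)) (h' : ∀ i, θ (.inr i) = η (.inr i)) (k : ℕ) :
    (∀ x ∈ S, θ.liftN k (.inl x) = η.liftN k (.inl x)) ∧
      ∀ i, θ.liftN k (.inr i) = η.liftN k (.inr i) := by
  induction k with
  | zero => exact ⟨h, h'⟩
  | succ k ih => exact Sub.lift_congr ih.1 ih.2

theorem FO.subst_subst {n m l : ℕ} (φ : FO L Ob n) (θ : Sub L Ob n m) (η : Sub L Ob m l) :
    FO.subst η (FO.subst θ φ) = FO.subst (θ.comp η) φ := by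
  induction φ generalizing m l with
  | ext a => exact a.elim
  | top => rfl
  | bot => rfl
  | eq t s => exact congrArg₂ Fml.eq (tm_subst_subst t θ η) (tm_subst_subst s θ η)
  | rel R ts => exact congrArg (Fml.rel R) (funext fun i => tm_subst_subst (ts i) θ η)
  | neg φ ih => simpa [FO.subst, Fml.substWith] using ih θ η
  | and φ ψ ih ih' => exact congrArg₂ Fml.and (ih θ η) (ih' θ η)
  | or φ ψ ih ih' => exact congrArg₂ Fml.or (ih θ η) (ih' θ η)
  | imp φ ψ ih ih' => exact congrArg₂ Fml.imp (ih θ η) (ih' θ η)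
  | iff φ ψ ih ih' => exact congrArg₂ Fml.iff (ih θ η) (ih' θ η)
  | all φ ih =>
    refine congrArg Fml.all ((ih θ.lift η.lift).trans ?_)
    rw [Sub.lift_comp]; rfl
  | ex φ ih =>
    refine congrArg Fml.ex ((ih θ.lift η.lift).trans ?_)
    rw [Sub.lift_comp]; rfl

theorem FO.subst_id {n : ℕ} (φ : FO L Ob n) : FO.subst (Sub.ident n) φ = φ := by
  induction φ with
  | ext a => exact a.elim
  | top => rfl
  | bot => rfl
  | eq t s => exact congrArg₂ Fml.eq (tm_subst_id t) (tm_subst_id s)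
  | rel R ts => exact congrArg (Fml.rel R) (funext fun i => tm_subst_id (ts i))
  | neg φ ih => exact congrArg Fml.neg ih
  | and φ ψ ih ih' => exact congrArg₂ Fml.and ih ih'
  | or φ ψ ih ih' => exact congrArg₂ Fml.or ih ih'
  | imp φ ψ ih ih' => exact congrArg₂ Fml.imp ih ih'
  | iff φ ψ ih ih' => exact congrArg₂ Fml.iff ih ih'
  | all φ ih =>
    refine congrArg Fml.all (Eq.trans ?_ ih)
    rw [Sub.lift_id]; rfl
  | ex φ ih =>
    refine congrArg Fml.ex (Eq.trans ?_ ih)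
    rw [Sub.lift_id]; rfl

theorem FO.subst_congr {n m : ℕ} {θ η : Sub L Ob n m} (φ : FO L Ob n)
    (h : ∀ x ∈ FO.free φ, θ (.inl x) = η (.inl x)) (h' : ∀ i, θ (.inr i) = η (.inr i)) :
    FO.subst θ φ = FO.subst η φ := by
  induction φ generalizing m with
  | ext a => exact a.elim
  | top => rfl
  | bot => rfl
  | eq t s =>
    exact congrArg₂ Fml.eq (tm_subst_congr t (fun x hx => h x (.inl hx)) h')
      (tm_subst_congr s (fun x hx => h x (.inr hx)) h')
  | rel R ts =>
    exact congrArg (Fml.rel R) (funext fun i =>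
      tm_subst_congr (ts i) (fun x hx => h x (Set.mem_iUnion.2 ⟨i, hx⟩)) h')
  | neg φ ih => exact congrArg Fml.neg (ih h h')
  | and φ ψ ih ih' =>
    exact congrArg₂ Fml.and (ih (fun x hx => h x (.inl hx)) h') (ih' (fun x hx => h x (.inr hx)) h')
  | or φ ψ ih ih' =>
    exact congrArg₂ Fml.or (ih (fun x hx => h x (.inl hx)) h') (ih' (fun x hx => h x (.inr hx)) h')
  | imp φ ψ ih ih' =>
    exact congrArg₂ Fml.imp (ih (fun x hx => h x (.inl hx)) h') (ih' (fun x hx => h x (.inr hx)) h')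
  | iff φ ψ ih ih' =>
    exact congrArg₂ Fml.iff (ih (fun x hx => h x (.inl hx)) h') (ih' (fun x hx => h x (.inr hx)) h')
  | all φ ih =>
    have hl := Sub.lift_congr (S := FO.free φ) h h'
    exact congrArg Fml.all (ih hl.1 hl.2)
  | ex φ ih =>
    have hl := Sub.lift_congr (S := FO.free φ) h h'
    exact congrArg Fml.ex (ih hl.1 hl.2)

theorem Rule.subst_id {n : ℕ} (r : Rule L Ob n) : Rule.subst (Sub.ident n) r = r := by
  cases r with
  | mk nv pred head body =>
    simp only [Rule.subst, Sub.liftN_id, FO.subst_id, tm_subst_id]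

/-- The equality rule substitutes in the whole sequent, its definitions included; this lets
definitions survive a substitution for fresh object symbols. -/
theorem Defn.subst_eq_self {n : ℕ} {θ : Sub L Ob n n} (Φ : Defn L Ob n)
    (h : ∀ x ∈ Defn.free Φ, θ (.inl x) = ob x) (h' : ∀ i, θ (.inr i) = bv i) :
    Defn.subst θ Φ = Φ := by
  have key : ∀ r ∈ Φ, Rule.subst θ r = r := by
    intro r hr
    have hx : ∀ x ∈ (⋃ i, tmFree (r.head i)) ∪ FO.free r.body,
        θ (.inl x) = Sub.ident n (.inl x) :=
      fun x hx => h x (Set.mem_iUnion₂.2 ⟨r, hr, hx⟩)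
    have hk := Sub.liftN_congr hx (η := Sub.ident n) h' r.nv
    refine Eq.trans ?_ (Rule.subst_id r)
    simp only [Rule.subst, Rule.mk.injEq, heq_eq_eq, true_and]
    exact ⟨funext fun i => tm_subst_congr _
      (fun x hx => hk.1 x (.inl (Set.mem_iUnion.2 ⟨i, hx⟩))) hk.2,
      FO.subst_congr _ (fun x hx => hk.1 x (.inr hx)) hk.2⟩
  classical
  ext r
  simp only [Defn.subst, Finset.mem_image]
  constructor
  · rintro ⟨r', hr', rfl⟩
    rwa [key r' hr']
  · intro hr
    exact ⟨r, hr, key r hr⟩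

theorem FO.toID_subst {n m : ℕ} (θ : Sub L Ob n m) (φ : FO L Ob n) :
    FOIDFml.subst θ (FO.toID φ) = FO.toID (FO.subst θ φ) := by
  induction φ generalizing m with
  | ext a => exact a.elim
  | top => rfl
  | bot => rfl
  | eq t s => rfl
  | rel R ts => rfl
  | neg φ ih => exact congrArg Fml.neg (ih θ)
  | and φ ψ ih ih' => exact congrArg₂ Fml.and (ih θ) (ih' θ)
  | or φ ψ ih ih' => exact congrArg₂ Fml.or (ih θ) (ih' θ)
  | imp φ ψ ih ih' => exact congrArg₂ Fml.imp (ih θ) (ih' θ)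
  | iff φ ψ ih ih' => exact congrArg₂ Fml.iff (ih θ) (ih' θ)
  | all φ ih => exact congrArg Fml.all (ih θ.lift)
  | ex φ ih => exact congrArg Fml.ex (ih θ.lift)

theorem FO.toID_free {n : ℕ} (φ : FO L Ob n) : FOIDFml.free (FO.toID φ) = FO.free φ := by
  induction φ with
  | ext a => exact a.elim
  | top => rfl
  | bot => rfl
  | eq t s => rfl
  | rel R ts => rfl
  | neg φ ih => exact ih
  | and φ ψ ih ih' => exact congrArg₂ (· ∪ ·) ih ih'
  | or φ ψ ih ih' => exact congrArg₂ (· ∪ ·) ih ih'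
  | imp φ ψ ih ih' => exact congrArg₂ (· ∪ ·) ih ih'
  | iff φ ψ ih ih' => exact congrArg₂ (· ∪ ·) ih ih'
  | all φ ih => exact ih
  | ex φ ih => exact ih

theorem tmFree_finite {n : ℕ} (t : Tm L Ob n) : (tmFree t).Finite := by
  classical exact Finset.finite_toSet _

theorem FO.free_finite {n : ℕ} (φ : FO L Ob n) : (FO.free φ).Finite := by
  induction φ with
  | ext a => exact a.elim
  | top => exact Set.finite_empty
  | bot => exact Set.finite_empty
  | eq t s => exact (tmFree_finite t).union (tmFree_finite s)
  | rel R ts => exact Set.finite_iUnion fun i => tmFree_finite (ts i)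
  | neg φ ih => exact ih
  | and φ ψ ih ih' => exact ih.union ih'
  | or φ ψ ih ih' => exact ih.union ih'
  | imp φ ψ ih ih' => exact ih.union ih'
  | iff φ ψ ih ih' => exact ih.union ih'
  | all φ ih => exact ih
  | ex φ ih => exact ih

theorem Defn.free_finite {n : ℕ} (Φ : Defn L Ob n) : (Defn.free Φ).Finite :=
  Φ.finite_toSet.biUnion fun r _ =>
    (Set.finite_iUnion fun i => tmFree_finite (r.head i)).union (FO.free_finite r.body)

/-- Replace all bound variables in scope by closed terms. -/
abbrev closing {n : ℕ} (t : Fin n → Tm L Ob 0) : Sub L Ob n 0 := Sum.elim ob t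

/-- Rules and quantifiers of closed expressions live over `0 + k` bound variables, while `closing`
acts on `k`; only a cast separates the two. -/
theorem Sub.inst_eq_closing {k : ℕ} (s : Fin k → Tm L Ob 0) :
    (Sub.inst s : Sub L Ob (0 + k) 0) = closing fun i => s (Fin.cast (zero_add k) i) := by
  funext z
  rcases z with x | i
  · rfl
  · induction i using Fin.addCases with
    | left i => exact i.elim0
    | right i =>
      simp only [Sub.inst, Sum.elim_inr, Fin.append_right]
      congr 1
      ext
      simp

theorem Sub.inst_one_eq_closing (t : Tm L Ob 0) :
    (Sub.inst fun _ : Fin 1 => t) = closing (n := 1) fun _ => t :=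
  Sub.inst_eq_closing _

theorem tm_relabel_subst_closing (t : Tm L Ob 0) (s : Fin (0 + 1) → Tm L Ob 0) :
    (t.relabel (Sum.map id Fin.castSucc)).subst (closing s) = t := by
  rw [tm_relabel_eq_subst, tm_subst_subst]
  refine Eq.trans ?_ (tm_subst_id t)
  congr 1
  funext z
  rcases z with x | i
  · rfl
  · exact i.elim0

theorem Sub.lift_closing_comp {n : ℕ} (t : Fin n → Tm L Ob 0) (u : Tm L Ob 0) :
    (closing t).lift.comp (closing (n := 1) fun _ => u) =
      closing (Fin.snoc (α := fun _ => Tm L Ob 0) t u) := by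
  apply Sub.lift_ext
  · intro x; rfl
  · simp [Sub.comp, FirstOrder.Language.Term.subst]
  · intro i
    simp only [Sub.comp, Sub.lift_castSucc, Sum.elim_inr, Fin.snoc_castSucc]
    exact tm_relabel_subst_closing (t i) _

/-- The quantifier step of the truth lemma: instances of a closed-off quantified formula are
closings of its open matrix, so the induction can run on open formulas. -/
theorem FO.subst_closing_lift {k : ℕ} (φ : FO L Ob (k + 1)) (t : Fin k → Tm L Ob 0)
    (u : Tm L Ob 0) :
    FO.subst (closing (n := 1) fun _ => u) (FO.subst (closing t).lift φ) =
      FO.subst (closing (Fin.snoc (α := fun _ => Tm L Ob 0) t u)) φ := by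
  rw [← Sub.lift_closing_comp]
  exact FO.subst_subst φ _ _

theorem closing_comp_closing {n m : ℕ} (t : Fin n → Tm L Ob m) (s : Fin m → Tm L Ob 0) :
    Sub.comp (Sum.elim ob t) (closing s) = closing fun i => (t i).subst (closing s) := by
  funext z
  rcases z with x | i <;> rfl

end Substitution

/-! ### Retraction of the syntax onto a fragment. -/

section Fragments

variable {L : FirstOrder.Language.{u, u}} {Ob : Type u}

/-- A selection of object symbols, function symbols and predicate symbols, with a selected object
symbol. -/
structure Fragment (L : FirstOrder.Language.{u, u}) (Ob : Type u) : Type u where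
  obs : Set Ob
  funs : Set (Σ k, L.Functions k)
  rels : Set (Pred L)
  base : Ob
  base_mem : base ∈ obs

open Classical in
/-- Replace the object symbols and the function terms outside the fragment by its base symbol. -/
noncomputable def Fragment.tm (K : Fragment L Ob) {β : Type} : L.Term (Ob ⊕ β) → L.Term (Ob ⊕ β)
  | .var (.inl x) => .var (.inl (if x ∈ K.obs then x else K.base))
  | .var (.inr i) => .var (.inr i)
  | .func (l := k) f ts =>
    if (⟨k, f⟩ : Σ k, L.Functions k) ∈ K.funs then .func f fun i => K.tm (ts i)
    else .var (.inl K.base)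

open Classical in
/-- Replace the symbols of a formula outside the fragment: terms as in `Fragment.tm`, atoms by
`⊥`. -/
noncomputable def Fragment.fo (K : Fragment L Ob) : ∀ {n : ℕ}, FO L Ob n → FO L Ob n
  | _, .ext a => a.elim
  | _, .top => .top
  | _, .bot => .bot
  | _, .eq t s => .eq (K.tm t) (K.tm s)
  | _, .rel (k := k) R ts =>
    if (⟨k, R⟩ : Pred L) ∈ K.rels then .rel R fun i => K.tm (ts i) else .bot
  | _, .neg φ => .neg (K.fo φ)
  | _, .and φ ψ => .and (K.fo φ) (K.fo ψ)
  | _, .or φ ψ => .or (K.fo φ) (K.fo ψ)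
  | _, .imp φ ψ => .imp (K.fo φ) (K.fo ψ)
  | _, .iff φ ψ => .iff (K.fo φ) (K.fo ψ)
  | _, .all φ => .all (K.fo φ)
  | _, .ex φ => .ex (K.fo φ)

variable {K : Fragment L Ob}

theorem Fragment.tm_ob {n : ℕ} {x : Ob} (hx : x ∈ K.obs) : K.tm (ob x : Tm L Ob n) = ob x := by
  simp [Fragment.tm, hx]

/-- Idempotence is what allows the terms of the fragment to be defined as the fixed points of the
retraction. -/
theorem Fragment.tm_tm {β : Type} (t : L.Term (Ob ⊕ β)) : K.tm (K.tm t) = K.tm t := by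
  induction t with
  | var z =>
    rcases z with x | i
    · by_cases hx : x ∈ K.obs <;> simp [Fragment.tm, hx, K.base_mem]
    · rfl
  | func f ts ih =>
    by_cases hf : (⟨_, f⟩ : Σ k, L.Functions k) ∈ K.funs <;>
      simp [Fragment.tm, hf, K.base_mem, ih]

theorem Fragment.fo_fo {n : ℕ} (φ : FO L Ob n) : K.fo (K.fo φ) = K.fo φ := by
  induction φ with
  | ext a => exact a.elim
  | rel R ts =>
    by_cases hR : (⟨_, R⟩ : Pred L) ∈ K.rels <;> simp [Fragment.fo, hR, Fragment.tm_tm]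
  | _ => simp_all [Fragment.fo, Fragment.tm_tm]

theorem Fragment.tm_relabel {n : ℕ} (t : Tm L Ob n) :
    K.tm (t.relabel (Sum.map id Fin.castSucc)) =
      (K.tm t).relabel (Sum.map id Fin.castSucc) := by
  induction t with
  | var z => rcases z with x | i <;> simp [Fragment.tm, FirstOrder.Language.Term.relabel]
  | func f ts ih =>
    by_cases hf : (⟨_, f⟩ : Σ k, L.Functions k) ∈ K.funs <;>
      simp [Fragment.tm, FirstOrder.Language.Term.relabel, hf, ih]

theorem Fragment.tm_subst {n m : ℕ} (t : Tm L Ob n) (θ : Sub L Ob n m)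
    (hθ : ∀ x, θ (.inl x) = ob x) :
    K.tm (t.subst θ) = (K.tm t).subst (Sum.elim ob fun i => K.tm (θ (.inr i))) := by
  induction t with
  | var z =>
    rcases z with x | i <;> simp [Fragment.tm, FirstOrder.Language.Term.subst, hθ]
  | func f ts ih =>
    by_cases hf : (⟨_, f⟩ : Σ k, L.Functions k) ∈ K.funs <;>
      simp [Fragment.tm, FirstOrder.Language.Term.subst, hf, ih]

theorem Fragment.fo_subst {n m : ℕ} (φ : FO L Ob n) (θ : Sub L Ob n m)
    (hθ : ∀ x, θ (.inl x) = ob x) :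
    K.fo (FO.subst θ φ) = FO.subst (Sum.elim ob fun i => K.tm (θ (.inr i))) (K.fo φ) := by
  have lift {n m : ℕ} (θ : Sub L Ob n m) (hθ : ∀ x, θ (.inl x) = ob x) :
      (∀ x, θ.lift (.inl x) = ob x) ∧ (Sum.elim ob fun i => K.tm (θ.lift (.inr i))) =
        Sub.lift (Sum.elim ob fun i => K.tm (θ (.inr i))) := by
    refine ⟨fun x => by simp [hθ, FirstOrder.Language.Term.relabel], ?_⟩
    apply Sub.lift_ext
    · intro x; simp [FirstOrder.Language.Term.relabel]
    · simp [Fragment.tm]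
    · intro i; simp [Fragment.tm_relabel]
  induction φ generalizing m with
  | ext a => exact a.elim
  | top => rfl
  | bot => rfl
  | eq t s => exact congrArg₂ Fml.eq (Fragment.tm_subst t θ hθ) (Fragment.tm_subst s θ hθ)
  | rel R ts =>
    by_cases hR : (⟨_, R⟩ : Pred L) ∈ K.rels
    · simp [FO.subst, Fml.substWith, Fragment.fo, hR, Fragment.tm_subst _ θ hθ]
    · simp [FO.subst, Fml.substWith, Fragment.fo, hR]
  | neg φ ih => exact congrArg Fml.neg (ih θ hθ)
  | and φ ψ ih ih' => exact congrArg₂ Fml.and (ih θ hθ) (ih' θ hθ)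
  | or φ ψ ih ih' => exact congrArg₂ Fml.or (ih θ hθ) (ih' θ hθ)
  | imp φ ψ ih ih' => exact congrArg₂ Fml.imp (ih θ hθ) (ih' θ hθ)
  | iff φ ψ ih ih' => exact congrArg₂ Fml.iff (ih θ hθ) (ih' θ hθ)
  | all φ ih =>
    refine congrArg Fml.all ((ih θ.lift (lift θ hθ).1).trans ?_)
    rw [(lift θ hθ).2]; rfl
  | ex φ ih =>
    refine congrArg Fml.ex ((ih θ.lift (lift θ hθ).1).trans ?_)
    rw [(lift θ hθ).2]; rfl

/-- Terms of the fragment. -/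
def Fragment.IsTm (K : Fragment L Ob) {n : ℕ} (t : Tm L Ob n) : Prop := K.tm t = t

/-- Formulas of the fragment. -/
def Fragment.IsFO (K : Fragment L Ob) {n : ℕ} (φ : FO L Ob n) : Prop := K.fo φ = φ

theorem Fragment.IsFO.subst {n m : ℕ} {φ : FO L Ob n} (hφ : K.IsFO φ) {s : Fin n → Tm L Ob m}
    (hs : ∀ i, K.IsTm (s i)) : K.IsFO (FO.subst (Sum.elim ob s) φ) := by
  have : (fun i => K.tm (s i)) = s := funext hs
  simp only [Fragment.IsFO] at hφ ⊢
  rw [Fragment.fo_subst φ (Sum.elim ob s) (fun _ => rfl), hφ]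
  simp [this]

theorem Fragment.IsTm.subst {n m : ℕ} {t : Tm L Ob n} (ht : K.IsTm t) {s : Fin n → Tm L Ob m}
    (hs : ∀ i, K.IsTm (s i)) : K.IsTm (t.subst (Sum.elim ob s)) := by
  have : (fun i => K.tm (s i)) = s := funext hs
  simp only [Fragment.IsTm] at ht ⊢
  rw [Fragment.tm_subst t (Sum.elim ob s) (fun _ => rfl), ht]
  simp [this]

@[simp] theorem Fragment.isFO_eq {n : ℕ} {t s : Tm L Ob n} :
    K.IsFO (.eq t s) ↔ K.IsTm t ∧ K.IsTm s := by
  simp [Fragment.IsFO, Fragment.IsTm, Fragment.fo]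

@[simp] theorem Fragment.isFO_rel {n k : ℕ} {R : L.Relations k} {ts : Fin k → Tm L Ob n} :
    K.IsFO (.rel R ts) ↔ (⟨k, R⟩ : Pred L) ∈ K.rels ∧ ∀ i, K.IsTm (ts i) := by
  by_cases hR : (⟨_, R⟩ : Pred L) ∈ K.rels <;>
    simp [Fragment.IsFO, Fragment.IsTm, Fragment.fo, hR, funext_iff]

@[simp] theorem Fragment.isFO_neg {n : ℕ} {φ : FO L Ob n} : K.IsFO (.neg φ) ↔ K.IsFO φ := by
  simp [Fragment.IsFO, Fragment.fo]

@[simp] theorem Fragment.isFO_and {n : ℕ} {φ ψ : FO L Ob n} :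
    K.IsFO (.and φ ψ) ↔ K.IsFO φ ∧ K.IsFO ψ := by
  simp [Fragment.IsFO, Fragment.fo]

@[simp] theorem Fragment.isFO_or {n : ℕ} {φ ψ : FO L Ob n} :
    K.IsFO (.or φ ψ) ↔ K.IsFO φ ∧ K.IsFO ψ := by
  simp [Fragment.IsFO, Fragment.fo]

@[simp] theorem Fragment.isFO_imp {n : ℕ} {φ ψ : FO L Ob n} :
    K.IsFO (.imp φ ψ) ↔ K.IsFO φ ∧ K.IsFO ψ := by
  simp [Fragment.IsFO, Fragment.fo]

@[simp] theorem Fragment.isFO_iff {n : ℕ} {φ ψ : FO L Ob n} :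
    K.IsFO (.iff φ ψ) ↔ K.IsFO φ ∧ K.IsFO ψ := by
  simp [Fragment.IsFO, Fragment.fo]

@[simp] theorem Fragment.isFO_all {n : ℕ} {φ : FO L Ob (n + 1)} :
    K.IsFO (.all φ) ↔ K.IsFO φ := by
  simp [Fragment.IsFO, Fragment.fo]

@[simp] theorem Fragment.isFO_ex {n : ℕ} {φ : FO L Ob (n + 1)} :
    K.IsFO (.ex φ) ↔ K.IsFO φ := by
  simp [Fragment.IsFO, Fragment.fo]

@[simp] theorem Fragment.isFO_bot {n : ℕ} : K.IsFO (.bot : FO L Ob n) := rfl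

theorem Fragment.isTm_ob {n : ℕ} {x : Ob} (hx : x ∈ K.obs) : K.IsTm (ob x : Tm L Ob n) :=
  Fragment.tm_ob hx

theorem Fragment.isTm_bv {n : ℕ} (i : Fin n) : K.IsTm (bv i : Tm L Ob n) := rfl

/-- Keeps the left formulas of minor premises inside the fragment. -/
theorem Fragment.IsFO.replace {n : ℕ} {ψ : FO L Ob n} (hψ : K.IsFO ψ) {Pi : Set (Pred L)}
    {F : ∀ Q : Pred L, FO L Ob Q.1} (hF : ∀ Q ∈ Pi, K.IsFO (F Q)) (b : Bool) :
    K.IsFO (FO.replace Pi F b ψ) := by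
  induction ψ generalizing b with
  | ext a => exact a.elim
  | rel R ts =>
    by_cases h : b = true ∧ (⟨_, R⟩ : Pred L) ∈ Pi
    · simpa [FO.replace, h] using (hF _ h.2).subst (Fragment.isFO_rel.1 hψ).2
    · simpa only [FO.replace, h, if_false] using hψ
  | neg φ ih => exact Fragment.isFO_neg.2 (ih (Fragment.isFO_neg.1 hψ) _)
  | and φ ψ ih ih' =>
    have h := Fragment.isFO_and.1 hψ
    exact Fragment.isFO_and.2 ⟨ih h.1 _, ih' h.2 _⟩
  | or φ ψ ih ih' =>
    have h := Fragment.isFO_or.1 hψ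
    exact Fragment.isFO_or.2 ⟨ih h.1 _, ih' h.2 _⟩
  | imp φ ψ ih ih' =>
    have h := Fragment.isFO_imp.1 hψ
    exact Fragment.isFO_imp.2 ⟨ih h.1 _, ih' h.2 _⟩
  | iff φ ψ ih ih' =>
    have h := Fragment.isFO_iff.1 hψ
    exact Fragment.isFO_and.2 ⟨Fragment.isFO_imp.2 ⟨ih h.1 _, ih' h.2 _⟩,
      Fragment.isFO_imp.2 ⟨ih' h.2 _, ih h.1 _⟩⟩
  | all φ ih => exact Fragment.isFO_all.2 (ih (Fragment.isFO_all.1 hψ) _)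
  | ex φ ih => exact Fragment.isFO_ex.2 (ih (Fragment.isFO_ex.1 hψ) _)
  | _ => exact hψ

theorem Fragment.isFO_alls {n : ℕ} {φ : FO L Ob n} (hφ : K.IsFO φ) : K.IsFO (Fml.alls φ) := by
  induction n with
  | zero => exact hφ
  | succ n ih => exact ih (Fragment.isFO_all.2 hφ)

end Fragments

/-! ### Countability of the terms and formulas of a fragment. -/

section Countability

variable {L : FirstOrder.Language.{u, u}} {Ob : Type u} {K : Fragment L Ob}

theorem Fragment.countable_tm (ho : K.obs.Countable) (hf : K.funs.Countable) (n : ℕ) :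
    {t : Tm L Ob n | K.IsTm t}.Countable := by
  let A : Set ((Ob ⊕ Fin n) ⊕ (Σ k, L.Functions k)) :=
    (Sum.inl '' (Sum.inl '' K.obs ∪ Set.range Sum.inr)) ∪ Sum.inr '' K.funs
  have hA : A.Countable :=
    (((ho.image _).union (Set.countable_range _)).image _).union (hf.image _)
  have hl : {l : List _ | ∀ z ∈ l, z ∈ A}.Countable := by
    have := hA.to_subtype
    rw [← Set.range_list_map_coe]
    exact Set.countable_range _
  refine (Set.MapsTo.countable_of_injOn (f := FirstOrder.Language.Term.listEncode) ?_
    FirstOrder.Language.Term.listEncode_injective.injOn hl)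
  intro t ht
  change K.tm t = t at ht
  -- Passing from `t` to `K.tm t` frees the induction from the hypothesis on `t`: the retract of any
  -- term is coded by symbols in `A`.
  rw [Set.mem_ofPred_eq, ← ht]
  clear ht
  induction t with
  | var z =>
    rcases z with x | i
    · by_cases hx : x ∈ K.obs <;>
        simp [Fragment.tm, FirstOrder.Language.Term.listEncode, A, hx, K.base_mem]
    · simp [Fragment.tm, FirstOrder.Language.Term.listEncode, A]
  | func f ts ih =>
    by_cases hx : (⟨_, f⟩ : Σ k, L.Functions k) ∈ K.funs
    · simp only [Fragment.tm, hx, if_true, FirstOrder.Language.Term.listEncode, List.mem_cons,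
        List.mem_flatMap, List.mem_finRange, true_and]
      rintro z (rfl | ⟨i, hi⟩)
      · exact .inr ⟨_, hx, rfl⟩
      · exact ih i z hi
    · simp [Fragment.tm, FirstOrder.Language.Term.listEncode, A, hx, K.base_mem]

/-- The nesting depth of connectives and quantifiers. -/
def FO.depth : ∀ {n : ℕ}, FO L Ob n → ℕ
  | _, .ext a => a.elim
  | _, .top => 0
  | _, .bot => 0
  | _, .eq _ _ => 0
  | _, .rel _ _ => 0
  | _, .neg φ => FO.depth φ + 1
  | _, .and φ ψ => max (FO.depth φ) (FO.depth ψ) + 1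
  | _, .or φ ψ => max (FO.depth φ) (FO.depth ψ) + 1
  | _, .imp φ ψ => max (FO.depth φ) (FO.depth ψ) + 1
  | _, .iff φ ψ => max (FO.depth φ) (FO.depth ψ) + 1
  | _, .all φ => FO.depth φ + 1
  | _, .ex φ => FO.depth φ + 1

theorem Fragment.countable_fo (ho : K.obs.Countable) (hf : K.funs.Countable)
    (hr : K.rels.Countable) (n : ℕ) : {φ : FO L Ob n | K.IsFO φ}.Countable := by
  -- The number of bound variables varies with the depth because quantifiers raise it.
  have step : ∀ d n, {φ : FO L Ob n | K.IsFO φ ∧ FO.depth φ < d}.Countable := by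
    intro d
    induction d with
    | zero => intro n; simp
    | succ d ih =>
      intro n
      have hT := Fragment.countable_tm ho hf n
      have hrel : (⋃ P ∈ K.rels, (Fml.rel (A := fun _ => PEmpty.{u + 1}) P.2) ''
          Set.pi Set.univ fun _ : Fin P.1 => {t : Tm L Ob n | K.IsTm t}).Countable :=
        hr.biUnion fun P _ => (Set.countable_univ_pi fun _ => hT).image _
      refine ((Set.countable_singleton Fml.top).union <| (Set.countable_singleton Fml.bot).union <|
        (hT.image2 hT Fml.eq).union <| hrel.union <| ((ih n).image Fml.neg).union <|
        ((ih n).image2 (ih n) Fml.and).union <| ((ih n).image2 (ih n) Fml.or).union <|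
        ((ih n).image2 (ih n) Fml.imp).union <| ((ih n).image2 (ih n) Fml.iff).union <|
        ((ih (n + 1)).image Fml.all).union <| ((ih (n + 1)).image Fml.ex)).mono ?_
      rintro φ ⟨hφ, hd⟩
      simp only [Set.mem_union, Set.mem_singleton_iff, Set.mem_image2, Set.mem_image,
        Set.mem_iUnion, Set.mem_ofPred_eq, Set.mem_pi, Set.mem_univ, true_imp_iff]
      cases φ with
      | ext a => exact a.elim
      | rel R ts =>
        have := Fragment.isFO_rel.1 hφ
        exact .inr <| .inr <| .inr <| .inl ⟨⟨_, R⟩, this.1, ts, this.2, rfl⟩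
      | _ => simp_all [FO.depth]
  refine (Set.countable_iUnion fun d => step d n).mono ?_
  intro φ hφ
  exact Set.mem_iUnion.2 ⟨FO.depth φ + 1, hφ, Nat.lt_succ_self _⟩

end Countability

/-! ### Finite support: every expression lies in all large fragments. -/

section Support

variable {L : FirstOrder.Language.{u, u}} {Ob : Type u}

/-- A property holds in all fragments with sufficiently many symbols. -/
def EventuallyFragment (p : Fragment L Ob → Prop) : Prop :=
  ∀ᶠ S : Finset Ob × Finset (Σ k, L.Functions k) × Finset (Pred L) in Filter.atTop,
    ∀ K : Fragment L Ob, ↑S.1 ⊆ K.obs → ↑S.2.1 ⊆ K.funs → ↑S.2.2 ⊆ K.rels → p K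

theorem EventuallyFragment.and {p q : Fragment L Ob → Prop} (hp : EventuallyFragment p)
    (hq : EventuallyFragment q) : EventuallyFragment fun K => p K ∧ q K := by
  filter_upwards [hp, hq] with S h h' K h1 h2 h3 using ⟨h K h1 h2 h3, h' K h1 h2 h3⟩

theorem EventuallyFragment.mono {p q : Fragment L Ob → Prop} (hp : EventuallyFragment p)
    (h : ∀ K, p K → q K) : EventuallyFragment q := by
  filter_upwards [hp] with S hS K h1 h2 h3 using h K (hS K h1 h2 h3)

theorem EventuallyFragment.of_forall {p : Fragment L Ob → Prop} (h : ∀ K, p K) :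
    EventuallyFragment p :=
  Filter.Eventually.of_forall fun _ K _ _ _ => h K

theorem EventuallyFragment.ball {ι : Type*} {s : Set ι} (hs : s.Finite)
    {p : ι → Fragment L Ob → Prop} (h : ∀ i ∈ s, EventuallyFragment (p i)) :
    EventuallyFragment fun K => ∀ i ∈ s, p i K := by
  filter_upwards [(Filter.eventually_all_finite hs).2 h] with S hS K h1 h2 h3 i hi
    using hS i hi K h1 h2 h3

theorem EventuallyFragment.all {ι : Type*} [Finite ι]
    {p : ι → Fragment L Ob → Prop} (h : ∀ i, EventuallyFragment (p i)) :
    EventuallyFragment fun K => ∀ i, p i K :=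
  (EventuallyFragment.ball Set.finite_univ fun i _ => h i).mono fun _ h i => h i (Set.mem_univ i)

theorem EventuallyFragment.obs (x : Ob) : EventuallyFragment fun K : Fragment L Ob => x ∈ K.obs := by
  filter_upwards [Filter.eventually_ge_atTop ({x}, ∅, ∅)] with S hS K h _ _
  exact h (hS.1 (Finset.mem_singleton_self x))

theorem EventuallyFragment.funs (f : Σ k, L.Functions k) :
    EventuallyFragment fun K : Fragment L Ob => f ∈ K.funs := by
  filter_upwards [Filter.eventually_ge_atTop (∅, {f}, ∅)] with S hS K _ h _
  exact h (hS.2.1 (Finset.mem_singleton_self f))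

theorem EventuallyFragment.rels (P : Pred L) :
    EventuallyFragment fun K : Fragment L Ob => P ∈ K.rels := by
  filter_upwards [Filter.eventually_ge_atTop (∅, ∅, {P})] with S hS K _ _ h
  exact h (hS.2.2 (Finset.mem_singleton_self P))

theorem eventually_isTm {n : ℕ} (t : Tm L Ob n) : EventuallyFragment fun K => K.IsTm t := by
  induction t with
  | var z =>
    rcases z with x | i
    · exact (EventuallyFragment.obs x).mono fun K h => Fragment.isTm_ob h
    · exact .of_forall fun K => rfl
  | func f ts ih =>
    refine ((EventuallyFragment.funs ⟨_, f⟩).and (EventuallyFragment.all ih)).mono ?_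
    rintro K ⟨hf, h⟩
    simp only [Fragment.IsTm] at h
    simp [Fragment.IsTm, Fragment.tm, hf, h]

theorem eventually_isFO {n : ℕ} (φ : FO L Ob n) : EventuallyFragment fun K => K.IsFO φ := by
  induction φ with
  | ext a => exact a.elim
  | top => exact .of_forall fun K => rfl
  | bot => exact .of_forall fun K => rfl
  | eq t s => simpa using (eventually_isTm t).and (eventually_isTm s)
  | rel R ts =>
    simpa using (EventuallyFragment.rels ⟨_, R⟩).and
      (EventuallyFragment.all fun i => eventually_isTm (ts i))
  | neg φ ih => simpa using ih
  | and φ ψ ih ih' => simpa using ih.and ih'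
  | or φ ψ ih ih' => simpa using ih.and ih'
  | imp φ ψ ih ih' => simpa using ih.and ih'
  | iff φ ψ ih ih' => simpa using ih.and ih'
  | all φ ih => simpa using ih
  | ex φ ih => simpa using ih

/-- Rules of the fragment. -/
structure Fragment.IsRule (K : Fragment L Ob) (r : Rule L Ob 0) : Prop where
  pred : r.pred ∈ K.rels
  head : ∀ i, K.IsTm (r.head i)
  body : K.IsFO r.body
  occurs : ∀ Q, FO.Occurs Q false r.body → Q ∈ K.rels

theorem Fragment.IsFO.mem_rels {K : Fragment L Ob} {n : ℕ} {φ : FO L Ob n} (hφ : K.IsFO φ)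
    {Q : Pred L} {b : Bool} (h : FO.Occurs Q b φ) : Q ∈ K.rels := by
  induction φ generalizing b with
  | ext a => exact a.elim
  | rel R ts => rw [h.2]; exact (Fragment.isFO_rel.1 hφ).1
  | neg φ ih => exact ih (by simpa using hφ) h
  | all φ ih => exact ih (by simpa using hφ) h
  | ex φ ih => exact ih (by simpa using hφ) h
  | and φ ψ ih ih' =>
    exact h.elim (ih (Fragment.isFO_and.1 hφ).1) (ih' (Fragment.isFO_and.1 hφ).2)
  | or φ ψ ih ih' =>
    exact h.elim (ih (Fragment.isFO_or.1 hφ).1) (ih' (Fragment.isFO_or.1 hφ).2)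
  | imp φ ψ ih ih' =>
    exact h.elim (ih (Fragment.isFO_imp.1 hφ).1) (ih' (Fragment.isFO_imp.1 hφ).2)
  | iff φ ψ ih ih' =>
    exact h.elim (fun h => h.elim (ih (Fragment.isFO_iff.1 hφ).1) (ih (Fragment.isFO_iff.1 hφ).1))
      (fun h => h.elim (ih' (Fragment.isFO_iff.1 hφ).2) (ih' (Fragment.isFO_iff.1 hφ).2))
  | _ => exact h.elim

theorem eventually_isRule (r : Rule L Ob 0) : EventuallyFragment fun K => K.IsRule r :=
  (((EventuallyFragment.rels r.pred).and
    (EventuallyFragment.all fun i => eventually_isTm (r.head i))).and (eventually_isFO r.body)).mono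
    fun _ h => ⟨h.1.1, h.1.2, h.2, fun _ => h.2.mem_rels⟩

/-- A property of all large fragments holds for a fragment with countably many symbols and
infinitely many object symbols. -/
theorem EventuallyFragment.exists_countable [Infinite Ob] {p : Fragment L Ob → Prop}
    (hp : EventuallyFragment p) : ∃ K : Fragment L Ob, p K ∧ K.obs.Infinite ∧ K.obs.Countable ∧
      K.funs.Countable ∧ K.rels.Countable := by
  classical
  obtain ⟨S, hS⟩ := Filter.Eventually.exists hp
  let e := Infinite.natEmbedding Ob
  refine ⟨⟨S.1 ∪ Set.range e, S.2.1, S.2.2, e 0, .inr ⟨0, rfl⟩⟩,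
    hS _ Set.subset_union_left subset_rfl subset_rfl, ?_, ?_, S.2.1.countable_toSet,
    S.2.2.countable_toSet⟩
  · exact (Set.infinite_range_of_injective e.injective).mono Set.subset_union_right
  · exact S.1.countable_toSet.union (Set.countable_range _)

end Support

/-! ### Semantics of substitution, replacement and change of predicates. -/

section Truth

variable {L : FirstOrder.Language.{u, u}} {Ob : Type u} {D : Type u}

/-- Truth of FO-formulas; see `Fml.Holds`. -/
abbrev FO.Holds [L.Structure D] (v : Ob → D) (J I : PredInterp L D) {n : ℕ} (φ : FO L Ob n)
    (e : Fin n → D) : Prop :=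
  Fml.Holds v (fun a _ => a.elim) J I φ e

/-- Negation exchanges the two interpretations, hence the opposite inclusions. -/
theorem FO.Holds.mono [L.Structure D] {v : Ob → D} {J J' I I' : PredInterp L D}
    (hJ : ∀ P, J P ⊆ J' P) (hI : ∀ P, I' P ⊆ I P) {n : ℕ} {φ : FO L Ob n} {e : Fin n → D}
    (h : FO.Holds v J I φ e) : FO.Holds v J' I' φ e := by
  induction φ generalizing J J' I I' with
  | ext a => exact a.elim
  | top => exact trivial
  | bot => exact h
  | eq t s => exact h
  | rel R ts => exact hJ _ h
  | neg φ ih => exact fun h' => h (ih hI hJ h')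
  | and φ ψ ih ih' => exact ⟨ih hJ hI h.1, ih' hJ hI h.2⟩
  | or φ ψ ih ih' => exact h.imp (ih hJ hI) (ih' hJ hI)
  | imp φ ψ ih ih' => exact fun h' => ih' hJ hI (h (ih hI hJ h'))
  | iff φ ψ ih ih' =>
    exact ⟨fun h' => ih' hJ hI (h.1 (ih hI hJ h')), fun h' => ih hJ hI (h.2 (ih' hI hJ h'))⟩
  | all φ ih => exact fun a => ih hJ hI (h a)
  | ex φ ih => exact h.imp fun a => ih hJ hI

/-- Truth depends on the second interpretation only at the predicate symbols that occur
negatively. -/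
theorem FO.holds_congr_right [L.Structure D] {v : Ob → D} {J I I' : PredInterp L D} {n : ℕ}
    {φ : FO L Ob n} (hI : ∀ P, FO.Occurs P false φ → I P = I' P) (e : Fin n → D) :
    FO.Holds v J I φ e ↔ FO.Holds v J I' φ e := by
  -- Both interpretations must vary, since negation swaps their roles.
  have key : ∀ {n : ℕ} (φ : FO L Ob n) (J J' I I' : PredInterp L D) (e : Fin n → D),
      (∀ P, FO.Occurs P true φ → J P = J' P) → (∀ P, FO.Occurs P false φ → I P = I' P) →
      (FO.Holds v J I φ e ↔ FO.Holds v J' I' φ e) := by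
    intro n φ
    induction φ with
    | ext a => exact a.elim
    | top => intros; exact Iff.rfl
    | bot => intros; exact Iff.rfl
    | eq t s => intros; exact Iff.rfl
    | rel R ts =>
      intro J J' I I' e hJ _
      simp only [Fml.Holds, hJ ⟨_, R⟩ ⟨rfl, rfl⟩]
    | neg φ ih =>
      intro J J' I I' e hJ hI
      exact not_congr (ih _ _ _ _ e hI hJ)
    | and φ ψ ih ih' =>
      intro J J' I I' e hJ hI
      exact and_congr (ih _ _ _ _ e (fun P h => hJ P (.inl h)) fun P h => hI P (.inl h))
        (ih' _ _ _ _ e (fun P h => hJ P (.inr h)) fun P h => hI P (.inr h))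
    | or φ ψ ih ih' =>
      intro J J' I I' e hJ hI
      exact or_congr (ih _ _ _ _ e (fun P h => hJ P (.inl h)) fun P h => hI P (.inl h))
        (ih' _ _ _ _ e (fun P h => hJ P (.inr h)) fun P h => hI P (.inr h))
    | imp φ ψ ih ih' =>
      intro J J' I I' e hJ hI
      exact imp_congr (ih _ _ _ _ e (fun P h => hI P (.inl h)) fun P h => hJ P (.inl h))
        (ih' _ _ _ _ e (fun P h => hJ P (.inr h)) fun P h => hI P (.inr h))
    | iff φ ψ ih ih' =>
      intro J J' I I' e hJ hI
      exact and_congr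
        (imp_congr
          (ih _ _ _ _ e (fun P h => hI P (.inl (.inr h))) fun P h => hJ P (.inl (.inr h)))
          (ih' _ _ _ _ e (fun P h => hJ P (.inr (.inl h))) fun P h => hI P (.inr (.inl h))))
        (imp_congr
          (ih' _ _ _ _ e (fun P h => hI P (.inr (.inr h))) fun P h => hJ P (.inr (.inr h)))
          (ih _ _ _ _ e (fun P h => hJ P (.inl (.inl h))) fun P h => hI P (.inl (.inl h))))
    | all φ ih =>
      intro J J' I I' e hJ hI
      exact forall_congr' fun a => ih _ _ _ _ _ hJ hI
    | ex φ ih =>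
      intro J J' I I' e hJ hI
      exact exists_congr fun a => ih _ _ _ _ _ hJ hI
  exact key φ J J I I' e (fun _ _ => rfl) hI

theorem FO.holds_subst [L.Structure D] {v : Ob → D} (J I : PredInterp L D) {n m : ℕ}
    (φ : FO L Ob n) (s : Fin n → Tm L Ob m) (e : Fin m → D) :
    FO.Holds v J I (FO.subst (Sum.elim ob s) φ) e ↔
      FO.Holds v J I φ fun i => (s i).realize (Sum.elim v e) := by
  have tm {n m : ℕ} (t : Tm L Ob n) (s : Fin n → Tm L Ob m) (e : Fin m → D) :
      (t.subst (Sum.elim ob s)).realize (Sum.elim v e) =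
        t.realize (Sum.elim v fun i => (s i).realize (Sum.elim v e)) := by
    rw [FirstOrder.Language.Term.realize_subst]
    congr 1
    funext z
    rcases z with x | i <;> rfl
  have lift {n m : ℕ} (s : Fin n → Tm L Ob m) : Sub.lift (Sum.elim ob s) =
      Sum.elim ob (Fin.snoc (α := fun _ => Tm L Ob (m + 1))
        (fun i => (s i).relabel (Sum.map id Fin.castSucc)) (bv (Fin.last m))) := by
    apply Sub.lift_ext
    · intro x; simp [FirstOrder.Language.Term.relabel]
    · simp
    · intro i; simp
  have snoc {n m : ℕ} (s : Fin n → Tm L Ob m) (e : Fin m → D) (a : D) :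
      (fun i => ((Fin.snoc (α := fun _ => Tm L Ob (m + 1))
        (fun i => (s i).relabel (Sum.map id Fin.castSucc)) (bv (Fin.last m)) i).realize
          (Sum.elim v (Fin.snoc e a : Fin (m + 1) → D)) : D)) =
      (Fin.snoc (fun i => (s i).realize (Sum.elim v e)) a : Fin (n + 1) → D) := by
    funext i
    induction i using Fin.lastCases with
    | last => simp
    | cast i =>
      simp only [Fin.snoc_castSucc, FirstOrder.Language.Term.realize_relabel]
      congr 1
      funext z
      rcases z with x | i <;> simp
  induction φ generalizing m J I with
  | ext a => exact a.elim
  | top => exact Iff.rfl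
  | bot => exact Iff.rfl
  | eq t t' =>
    simp only [FO.subst, Fml.substWith, Fml.Holds]
    rw [tm, tm]
  | rel R ts =>
    simp only [FO.subst, Fml.substWith, Fml.Holds]
    simp only [tm]
  | neg φ ih => exact not_congr (ih _ _ s e)
  | and φ ψ ih ih' => exact and_congr (ih _ _ s e) (ih' _ _ s e)
  | or φ ψ ih ih' => exact or_congr (ih _ _ s e) (ih' _ _ s e)
  | imp φ ψ ih ih' => exact imp_congr (ih _ _ s e) (ih' _ _ s e)
  | iff φ ψ ih ih' =>
    exact and_congr (imp_congr (ih _ _ s e) (ih' _ _ s e)) (imp_congr (ih' _ _ s e) (ih _ _ s e))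
  | all φ ih =>
    refine forall_congr' fun a => ?_
    rw [lift]
    refine (ih _ _ _ _).trans ?_
    rw [snoc]
  | ex φ ih =>
    refine exists_congr fun a => ?_
    rw [lift]
    refine (ih _ _ _ _).trans ?_
    rw [snoc]

/-- The bridge between the induction rule and the operator `𝒞(J, I)`: the syntactic replacement of
positive atoms by defining formulas of `J` amounts to reading positive occurrences in `J`. -/
theorem FO.holds_replace [L.Structure D] {v : Ob → D} {J I : PredInterp L D} {Pi : Set (Pred L)}
    {F : ∀ Q : Pred L, FO L Ob Q.1}
    (hF : ∀ Q ∈ Pi, ∀ a, a ∈ J Q ↔ FO.Holds v I I (F Q) a) (hJ : ∀ Q ∉ Pi, J Q = I Q)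
    {n : ℕ} (ψ : FO L Ob n) (b : Bool) (e : Fin n → D) :
    FO.Holds v I I (FO.replace Pi F b ψ) e ↔
      FO.Holds v (if b then J else I) (if b then I else J) ψ e := by
  induction ψ generalizing b with
  | ext a => exact a.elim
  | top => exact Iff.rfl
  | bot => exact Iff.rfl
  | eq t t' => exact Iff.rfl
  | rel R ts =>
    by_cases h : b = true ∧ (⟨_, R⟩ : Pred L) ∈ Pi
    · simp only [FO.replace, h, and_self, if_true]
      rw [FO.holds_subst, ← hF _ h.2]
      exact Iff.rfl
    · simp only [FO.replace, h, if_false]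
      cases b
      · exact Iff.rfl
      · have hR : (⟨_, R⟩ : Pred L) ∉ Pi := fun h' => h ⟨rfl, h'⟩
        simp only [Fml.Holds, if_true, hJ _ hR]
  | neg φ ih => cases b <;> exact not_congr (ih _ e)
  | and φ ψ ih ih' => exact and_congr (ih _ e) (ih' _ e)
  | or φ ψ ih ih' => exact or_congr (ih _ e) (ih' _ e)
  | imp φ ψ ih ih' => cases b <;> exact imp_congr (ih _ e) (ih' _ e)
  | iff φ ψ ih ih' =>
    cases b <;> exact and_congr (imp_congr (ih _ e) (ih' _ e)) (imp_congr (ih' _ e) (ih _ e))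
  | all φ ih => exact forall_congr' fun a => ih _ _
  | ex φ ih => exact exists_congr fun a => ih _ _

theorem FO.toID_holds [L.Structure D] {v : Ob → D}
    (hA : ∀ {n : ℕ}, Defn L Ob n → (Fin n → D) → Prop) (J I : PredInterp L D) {n : ℕ}
    (φ : FO L Ob n) (e : Fin n → D) :
    Fml.Holds v hA J I (FO.toID φ) e ↔ FO.Holds v J I φ e := by
  induction φ generalizing J I with
  | ext a => exact a.elim
  | top => exact Iff.rfl
  | bot => exact Iff.rfl
  | eq t t' => exact Iff.rfl
  | rel R ts => exact Iff.rfl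
  | neg φ ih => exact not_congr (ih _ _ e)
  | and φ ψ ih ih' => exact and_congr (ih _ _ e) (ih' _ _ e)
  | or φ ψ ih ih' => exact or_congr (ih _ _ e) (ih' _ _ e)
  | imp φ ψ ih ih' => exact imp_congr (ih _ _ e) (ih' _ _ e)
  | iff φ ψ ih ih' =>
    exact and_congr (imp_congr (ih _ _ e) (ih' _ _ e)) (imp_congr (ih' _ _ e) (ih _ _ e))
  | all φ ih => exact forall_congr' fun a => ih _ _ _
  | ex φ ih => exact exists_congr fun a => ih _ _ _

theorem Defn.op_mono [L.Structure D] {v : Ob → D} {n : ℕ} {e : Fin n → D} {Φ : Defn L Ob n}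
    {J J' I : PredInterp L D} (h : ∀ P, J P ⊆ J' P) (P : Pred L) :
    Φ.op v e J I P ⊆ Φ.op v e J' I P := by
  rintro a ⟨r, hr, b, hb, hold⟩
  exact ⟨r, hr, b, hb, FO.Holds.mono h (fun _ => subset_rfl) hold⟩

theorem Defn.op_congr_right [L.Structure D] {v : Ob → D} {n : ℕ} {e : Fin n → D} {Φ : Defn L Ob n}
    {J I I' : PredInterp L D} (h : ∀ r ∈ Φ, ∀ Q, FO.Occurs Q false r.body → I Q = I' Q) :
    Φ.op v e J I = Φ.op v e J I' := by
  funext P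
  ext a
  refine exists_congr fun r => and_congr_right fun hr => exists_congr fun b =>
    and_congr_right fun _ => FO.holds_congr_right (h r hr) _

/-- The structure with the functions of `S` in which the predicates are interpreted by `I`. -/
abbrev withPreds (S : L.Structure D) (I : PredInterp L D) : L.Structure D where
  funMap := S.funMap
  RelMap R a := a ∈ I ⟨_, R⟩

theorem realize_withPreds (S : L.Structure D) (I : PredInterp L D) {α : Type*} (t : L.Term α)
    (w : α → D) : @FirstOrder.Language.Term.realize L D (withPreds S I) α w t =
      @FirstOrder.Language.Term.realize L D S α w t := by
  induction t with
  | var => rfl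
  | func f ts ih =>
    exact congrArg (S.funMap f) (funext ih)

/-- Truth of FO-formulas takes the predicates as arguments and reads only the functions off the
structure. So the term structure can be set up first and its predicates chosen later. -/
theorem holds_withPreds (S : L.Structure D) (I J J' : PredInterp L D) (v : Ob → D) {n : ℕ}
    (φ : FO L Ob n) (e : Fin n → D) :
    @FO.Holds L Ob D (withPreds S I) v J J' n φ e ↔ @FO.Holds L Ob D S v J J' n φ e := by
  induction φ generalizing J J' with
  | ext a => exact a.elim
  | top => exact Iff.rfl
  | bot => exact Iff.rfl
  | eq t t' => simp only [FO.Holds, Fml.Holds, realize_withPreds]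
  | rel R ts => simp only [FO.Holds, Fml.Holds, realize_withPreds]
  | neg φ ih => exact not_congr (ih _ _ e)
  | and φ ψ ih ih' => exact and_congr (ih _ _ e) (ih' _ _ e)
  | or φ ψ ih ih' => exact or_congr (ih _ _ e) (ih' _ _ e)
  | imp φ ψ ih ih' => exact imp_congr (ih _ _ e) (ih' _ _ e)
  | iff φ ψ ih ih' =>
    exact and_congr (imp_congr (ih _ _ e) (ih' _ _ e)) (imp_congr (ih' _ _ e) (ih _ _ e))
  | all φ ih => exact forall_congr' fun a => ih _ _ _
  | ex φ ih => exact exists_congr fun a => ih _ _ _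

theorem op_withPreds (S : L.Structure D) (I J J' : PredInterp L D) (v : Ob → D) {n : ℕ}
    (Φ : Defn L Ob n) (e : Fin n → D) :
    @Defn.op L Ob D (withPreds S I) v n e Φ J J' = @Defn.op L Ob D S v n e Φ J J' := by
  funext P
  ext a
  refine exists_congr fun r => and_congr_right fun hr => exists_congr fun b =>
    and_congr (by simp only [realize_withPreds]) (holds_withPreds S I J J' v r.body _)

theorem ofStructure_withPreds (S : L.Structure D) (I : PredInterp L D) :
    @PredInterp.ofStructure L D (withPreds S I) = I := rfl

end Truth

/-! ### The calculus restricted to sequents of FO-formulas with fixed definitions. -/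

section Sequents

variable {L : FirstOrder.Language.{u, u}} {Ob : Type u}

/-- Provability of the sequent `Γ, Φ₁, …, Φₙ ⊢ Δ` with cut formulas in `C`. -/
abbrev Prov (C : Set (FOIDFml L Ob 0)) {n : ℕ} (Φ : Fin n → Defn L Ob 0)
    (Γ Δ : Set (FO L Ob 0)) : Prop :=
  Provable C (antecedent Γ Φ) (succedent Δ)

theorem antecedent_insert {n : ℕ} (Φ : Fin n → Defn L Ob 0) (φ : FO L Ob 0)
    (Γ : Set (FO L Ob 0)) :
    antecedent (insert φ Γ) Φ = insert (FO.toID φ) (antecedent Γ Φ) := by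
  simp [antecedent, Set.image_insert_eq, Set.insert_union]

theorem succedent_insert (φ : FO L Ob 0) (Δ : Set (FO L Ob 0)) :
    succedent (insert φ Δ) = insert (FO.toID φ) (succedent Δ) := by
  simp [succedent, Set.image_insert_eq]

/-- The freely occurring object symbols of a sequent. -/
def seqFree {n : ℕ} (Φ : Fin n → Defn L Ob 0) (Γ Δ : Set (FO L Ob 0)) : Set Ob :=
  setFree (antecedent Γ Φ) ∪ setFree (succedent Δ)

theorem seqFree_finite {n : ℕ} (Φ : Fin n → Defn L Ob 0) {Γ Δ : Set (FO L Ob 0)}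
    (hΓ : Γ.Finite) (hΔ : Δ.Finite) : (seqFree Φ Γ Δ).Finite := by
  refine Set.Finite.union (Set.Finite.biUnion ((hΓ.image _).union (Set.finite_range _)) ?_)
    (Set.Finite.biUnion (hΔ.image _) ?_)
  · rintro _ (⟨φ, -, rfl⟩ | ⟨i, rfl⟩)
    · rw [FO.toID_free]; exact FO.free_finite φ
    · exact Defn.free_finite (Φ i)
  · rintro _ ⟨φ, -, rfl⟩
    rw [FO.toID_free]; exact FO.free_finite φ

theorem FOIDFml.inst_toID (φ : FO L Ob 1) (t : Tm L Ob 0) :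
    FOIDFml.subst (Sub.inst fun _ : Fin 1 => t) (FO.toID φ) =
      FO.toID (FO.subst (closing fun _ => t) φ) := by
  rw [Sub.inst_one_eq_closing]
  exact FO.toID_subst _ _

variable {C : Set (FOIDFml L Ob 0)} {n : ℕ} {Φ : Fin n → Defn L Ob 0} {Γ Δ : Set (FO L Ob 0)}
  {φ ψ : FO L Ob 0}

theorem Prov.mono {Γ' Δ' : Set (FO L Ob 0)} (h : Prov C Φ Γ Δ) (hΓ : Γ ⊆ Γ') (hΔ : Δ ⊆ Δ') :
    Prov C Φ Γ' Δ' :=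
  .wk (Set.union_subset_union_left _ (Set.image_mono hΓ)) (Set.image_mono hΔ) h

theorem Prov.ax (h : φ ∈ Γ) (h' : φ ∈ Δ) : Prov C Φ Γ Δ :=
  Provable.ax (.inl ⟨FO.toID φ, .inl ⟨φ, h, rfl⟩, φ, h', rfl⟩)

theorem Prov.botL (h : Fml.bot ∈ Γ) : Prov C Φ Γ Δ :=
  Provable.ax (.inr (.inl (.inl ⟨_, h, rfl⟩)))

theorem Prov.topR (h : Fml.top ∈ Δ) : Prov C Φ Γ Δ :=
  Provable.ax (.inr (.inr ⟨_, h, rfl⟩))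

theorem Prov.cut (hφ : FO.toID φ ∈ C) (h : Prov C Φ Γ (insert φ Δ))
    (h' : Prov C Φ (insert φ Γ) Δ) : Prov C Φ Γ Δ := by
  rw [Prov, succedent_insert] at h
  rw [Prov, antecedent_insert] at h'
  exact Provable.cut hφ h h'

theorem Prov.negL (h : Prov C Φ Γ (insert φ Δ)) : Prov C Φ (insert (.neg φ) Γ) Δ := by
  rw [Prov, succedent_insert] at h
  rw [Prov, antecedent_insert]
  exact Provable.negL h

theorem Prov.negR (h : Prov C Φ (insert φ Γ) Δ) : Prov C Φ Γ (insert (.neg φ) Δ) := by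
  rw [Prov, antecedent_insert] at h
  rw [Prov, succedent_insert]
  exact Provable.negR h

theorem Prov.orL (h : Prov C Φ (insert φ Γ) Δ) (h' : Prov C Φ (insert ψ Γ) Δ) :
    Prov C Φ (insert (.or φ ψ) Γ) Δ := by
  rw [Prov, antecedent_insert] at h h' ⊢
  exact Provable.orL h h'

theorem Prov.orR (h : Prov C Φ Γ (insert φ (insert ψ Δ))) : Prov C Φ Γ (insert (.or φ ψ) Δ) := by
  rw [Prov, succedent_insert, succedent_insert] at h
  rw [Prov, succedent_insert]
  exact Provable.orR h

theorem Prov.andL (h : Prov C Φ (insert φ (insert ψ Γ)) Δ) : Prov C Φ (insert (.and φ ψ) Γ) Δ := by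
  rw [Prov, antecedent_insert, antecedent_insert] at h
  rw [Prov, antecedent_insert]
  exact Provable.andL h

theorem Prov.andR (h : Prov C Φ Γ (insert φ Δ)) (h' : Prov C Φ Γ (insert ψ Δ)) :
    Prov C Φ Γ (insert (.and φ ψ) Δ) := by
  rw [Prov, succedent_insert] at h h' ⊢
  exact Provable.andR h h'

theorem Prov.impL (h : Prov C Φ Γ (insert φ Δ)) (h' : Prov C Φ (insert ψ Γ) Δ) :
    Prov C Φ (insert (.imp φ ψ) Γ) Δ := by
  rw [Prov, succedent_insert] at h
  rw [Prov, antecedent_insert] at h' ⊢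
  exact Provable.impL h h'

theorem Prov.impR (h : Prov C Φ (insert φ Γ) (insert ψ Δ)) :
    Prov C Φ Γ (insert (.imp φ ψ) Δ) := by
  rw [Prov, antecedent_insert, succedent_insert] at h
  rw [Prov, succedent_insert]
  exact Provable.impR h

theorem Prov.iffL (h : Prov C Φ Γ (insert φ (insert ψ Δ)))
    (h' : Prov C Φ (insert φ (insert ψ Γ)) Δ) : Prov C Φ (insert (.iff φ ψ) Γ) Δ := by
  rw [Prov, succedent_insert, succedent_insert] at h
  rw [Prov, antecedent_insert, antecedent_insert] at h'
  rw [Prov, antecedent_insert]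
  exact Provable.iffL h h'

theorem Prov.iffR (h : Prov C Φ (insert φ Γ) (insert ψ Δ))
    (h' : Prov C Φ (insert ψ Γ) (insert φ Δ)) : Prov C Φ Γ (insert (.iff φ ψ) Δ) := by
  rw [Prov, antecedent_insert, succedent_insert] at h h'
  rw [Prov, succedent_insert]
  exact Provable.iffR h h'

theorem Prov.allL {φ : FO L Ob 1} (t : Tm L Ob 0)
    (h : Prov C Φ (insert (FO.subst (closing fun _ => t) φ) Γ) Δ) :
    Prov C Φ (insert (.all φ) Γ) Δ := by
  rw [Prov, antecedent_insert, ← FOIDFml.inst_toID] at h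
  rw [Prov, antecedent_insert]
  exact Provable.allL t h

theorem Prov.exR {φ : FO L Ob 1} (t : Tm L Ob 0)
    (h : Prov C Φ Γ (insert (FO.subst (closing fun _ => t) φ) Δ)) :
    Prov C Φ Γ (insert (.ex φ) Δ) := by
  rw [Prov, succedent_insert, ← FOIDFml.inst_toID] at h
  rw [Prov, succedent_insert]
  exact Provable.exR t h

theorem Prov.allR {φ : FO L Ob 1} {x : Ob} (hx : x ∉ seqFree Φ Γ Δ) (hφ : x ∉ FO.free φ)
    (h : Prov C Φ Γ (insert (FO.subst (closing fun _ => ob x) φ) Δ)) :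
    Prov C Φ Γ (insert (.all φ) Δ) := by
  rw [Prov, succedent_insert, ← FOIDFml.inst_toID] at h
  rw [Prov, succedent_insert]
  exact Provable.allR x (fun h => hx (.inl h)) (fun h => hx (.inr h)) (by rwa [FO.toID_free]) h

theorem Prov.exL {φ : FO L Ob 1} {x : Ob} (hx : x ∉ seqFree Φ Γ Δ) (hφ : x ∉ FO.free φ)
    (h : Prov C Φ (insert (FO.subst (closing fun _ => ob x) φ) Γ) Δ) :
    Prov C Φ (insert (.ex φ) Γ) Δ := by
  rw [Prov, antecedent_insert, ← FOIDFml.inst_toID] at h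
  rw [Prov, antecedent_insert]
  exact Provable.exL x (fun h => hx (.inl h)) (fun h => hx (.inr h)) (by rwa [FO.toID_free]) h

theorem Prov.eqR (t : Tm L Ob 0) : Prov C Φ Γ (insert (.eq t t) Δ) := by
  rw [Prov, succedent_insert]
  exact Provable.eqR t

open Classical in
theorem Sub.double_inl {m : ℕ} (x y : Ob) (t s : Tm L Ob m) (z : Ob) :
    (Sub.double x t y s : Sub L Ob m m) (.inl z) =
      if z = x then t else if z = y then s else ob z := by
  simp only [Sub.double, Sum.elim_inl, Function.update_apply]

theorem FOIDFml.subst_double_eq_self {x y : Ob} (t s : Tm L Ob 0) {χ : FOIDFml L Ob 0}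
    (hχ : (∃ φ : FO L Ob 0, FO.toID φ = χ) ∨ ∃ Ψ : Defn L Ob 0, Fml.ext Ψ = χ)
    (hx : x ∉ FOIDFml.free χ) (hy : y ∉ FOIDFml.free χ) :
    FOIDFml.subst (Sub.double x t y s) χ = χ := by
  have h {S : Set Ob} (hx : x ∉ S) (hy : y ∉ S) (z : Ob) (hz : z ∈ S) :
      (Sub.double x t y s : Sub L Ob 0 0) (.inl z) = ob z := by
    have h1 : z ≠ x := fun h => hx (h ▸ hz)
    have h2 : z ≠ y := fun h => hy (h ▸ hz)
    simp [Sub.double_inl, h1, h2]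
  rcases hχ with ⟨φ, rfl⟩ | ⟨Ψ, rfl⟩
  · rw [FO.toID_free] at hx hy
    rw [FO.toID_subst, FO.subst_congr (η := Sub.ident 0) φ (h hx hy) fun i => i.elim0, FO.subst_id]
  · exact congrArg Fml.ext (Defn.subst_eq_self Ψ (h hx hy) fun i => i.elim0)

/-- Replacement of equals by equals on the right side of a sequent. -/
theorem Prov.eqL [Infinite Ob] {t s : Tm L Ob 0} (hΓ : Γ.Finite) (hΔ : Δ.Finite) (A : FO L Ob 1)
    (h : Prov C Φ Γ (insert (FO.subst (closing fun _ => s) A) Δ)) :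
    Prov C Φ (insert (.eq t s) Γ) (insert (FO.subst (closing fun _ => t) A) Δ) ∧
    Prov C Φ (insert (.eq s t) Γ) (insert (FO.subst (closing fun _ => t) A) Δ) := by
  -- The rule replaces at two marks at once; both are taken fresh and only one is used, so the
  -- context and the definitions stay unchanged.
  obtain ⟨x, hx⟩ := ((seqFree_finite Φ hΓ hΔ).union (FO.free_finite A)).exists_notMem
  obtain ⟨y, hy⟩ :=
    (((seqFree_finite Φ hΓ hΔ).union (FO.free_finite A)).insert x).exists_notMem
  simp only [Set.mem_insert_iff, not_or, Set.mem_union, seqFree] at hx hy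
  obtain ⟨⟨hxΓ, hxΔ⟩, hxA⟩ := hx
  obtain ⟨hyx, ⟨hyΓ, hyΔ⟩, hyA⟩ := hy
  have hl (t s : Tm L Ob 0) :
      FOIDFml.subst (Sub.double x t y s) '' antecedent Γ Φ = antecedent Γ Φ := by
    refine (Set.image_congr fun χ hχ => ?_).trans (Set.image_id _)
    refine FOIDFml.subst_double_eq_self t s ?_ (fun h => hxΓ (Set.mem_biUnion hχ h))
      (fun h => hyΓ (Set.mem_biUnion hχ h))
    rcases hχ with ⟨φ, -, rfl⟩ | ⟨i, rfl⟩
    · exact .inl ⟨φ, rfl⟩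
    · exact .inr ⟨Φ i, rfl⟩
  have hr (t s : Tm L Ob 0) :
      FOIDFml.subst (Sub.double x t y s) '' succedent Δ = succedent Δ := by
    refine (Set.image_congr fun χ hχ => ?_).trans (Set.image_id _)
    refine FOIDFml.subst_double_eq_self t s ?_ (fun h => hxΔ (Set.mem_biUnion hχ h))
      (fun h => hyΔ (Set.mem_biUnion hχ h))
    rcases hχ with ⟨φ, -, rfl⟩
    exact .inl ⟨φ, rfl⟩
  have hA (z : Ob) (t s u : Tm L Ob 0)
      (hz : (Sub.double x t y s : Sub L Ob 0 0) (.inl z) = u) :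
      FOIDFml.subst (Sub.double x t y s) (FO.toID (FO.subst (closing fun _ => ob z) A)) =
        FO.toID (FO.subst (closing fun _ => u) A) := by
    rw [FO.toID_subst, FO.subst_subst]
    congr 1
    refine FO.subst_congr A (fun w hw => ?_) fun i => hz
    have h1 : w ≠ x := fun h => hxA (h ▸ hw)
    have h2 : w ≠ y := fun h => hyA (h ▸ hw)
    simp [Sub.comp, FirstOrder.Language.Term.subst, Sub.double_inl, h1, h2]
  have hxt (t s : Tm L Ob 0) := hA x t s t (by simp [Sub.double_inl])
  have hys (t s : Tm L Ob 0) := hA y t s s (by simp [Sub.double_inl, hyx])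
  simp only [Prov, antecedent_insert, succedent_insert] at h ⊢
  -- The mark `x` turns `s` into `t` under `t = s`; the mark `y`, with the two terms exchanged, does
  -- so under `s = t`.
  constructor
  · have := Provable.eqL (C := C) (Γ := antecedent Γ Φ)
      (Δ := insert (FO.toID (FO.subst (closing fun _ => ob x) A)) (succedent Δ)) x y t s
      (Ne.symm hyx) (by
        rw [Set.image_insert_eq, hl, hr, hxt]
        exact h)
    rw [Set.image_insert_eq, hl, hr, hxt] at this
    exact this
  · have := Provable.eqL (C := C) (Γ := antecedent Γ Φ)
      (Δ := insert (FO.toID (FO.subst (closing fun _ => ob y) A)) (succedent Δ)) x y s t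
      (Ne.symm hyx) (by
        rw [Set.image_insert_eq, hl, hr, hys]
        exact h)
    rw [Set.image_insert_eq, hl, hr, hys] at this
    exact this

theorem Prov.defR (i : Fin n) {r : Rule L Ob 0} (hr : r ∈ Φ i) (s : Fin r.nv → Tm L Ob 0)
    (h : Prov C Φ Γ (insert (FO.subst (Sub.inst s) r.body) Δ)) :
    Prov C Φ Γ (insert (.rel r.pred.2 fun j => (r.head j).subst (Sub.inst s)) Δ) := by
  rw [Prov, succedent_insert] at h ⊢
  exact Provable.defR (Φ i) r s (.inr ⟨i, rfl⟩) hr h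

/-- The left formula of the minor premise of the induction rule for the rule `r`. -/
noncomputable def minorBody (Pi : Set (Pred L)) (F : ∀ Q : Pred L, FO L Ob Q.1) (r : Rule L Ob 0)
    (y : Fin r.nv → Ob) : FO L Ob 0 :=
  FO.replace Pi F true (FO.subst (Sub.inst fun i => ob (y i)) r.body)

/-- The right formula of the minor premise of the induction rule for the rule `r`. -/
def minorHead (F : ∀ Q : Pred L, FO L Ob Q.1) (r : Rule L Ob 0) (y : Fin r.nv → Ob) :
    FO L Ob 0 :=
  FO.subst (closing fun j => (r.head j).subst (Sub.inst fun i => ob (y i))) (F r.pred)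

theorem Prov.defL (i : Fin n) (F : ∀ Q : Pred L, FO L Ob Q.1)
    (y : ∀ r : Rule L Ob 0, Fin r.nv → Ob) {P : Pred L} (v : Fin P.1 → Tm L Ob 0)
    (hP : P ∈ (Φ i).defined)
    (hy : ∀ r ∈ Φ i, Function.Injective (y r) ∧
      ∀ j, y r j ∉ seqFree Φ Γ Δ ∧ ∀ Q ∈ (Φ i).defined, y r j ∉ FO.free (F Q))
    (hminor : ∀ r ∈ Φ i, Prov C Φ (insert (minorBody (Φ i).defined F r (y r)) Γ)
      (insert (minorHead F r (y r)) Δ))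
    (hmajor : Prov C Φ (insert (FO.subst (closing v) (F P)) Γ) Δ) :
    Prov C Φ (insert (.rel P.2 v) Γ) Δ := by
  simp only [Prov, antecedent_insert, succedent_insert] at hminor hmajor ⊢
  exact Provable.defL (Φ i) (Φ i).defined F y P v (.inr ⟨i, rfl⟩) subset_rfl hP
    (fun r hr _ => ⟨(hy r hr).1, fun j => ⟨fun h => ((hy r hr).2 j).1 (.inl h),
      fun h => ((hy r hr).2 j).1 (.inr h), ((hy r hr).2 j).2⟩⟩)
    (fun r hr _ => hminor r hr) hmajor

end Sequents

/-! ### Construction of the saturated chain of unprovable sequents. -/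

section Chains

variable {L : FirstOrder.Language.{u, u}} {Ob : Type u}

/-- Extend a family of formulas for the defined predicates of a definition by `⊥`. -/
noncomputable def extendBot (Ψ : Defn L Ob 0) (F : ∀ Q : Ψ.defined, FO L Ob Q.1.1) (Q : Pred L) :
    FO L Ob Q.1 :=
  open Classical in if h : Q ∈ Ψ.defined then F ⟨Q, h⟩ else .bot

/-- An increasing sequence of finite unprovable sequents over a fragment whose limit is maximal,
has witnesses, and is closed under the induction rule. -/
structure SaturatedChain (C : Set (FOIDFml L Ob 0)) {n : ℕ} (Φ : Fin n → Defn L Ob 0)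
    (K : Fragment L Ob) where
  left : ℕ → Set (FO L Ob 0)
  right : ℕ → Set (FO L Ob 0)
  left_mono : Monotone left
  right_mono : Monotone right
  left_finite : ∀ m, (left m).Finite
  right_finite : ∀ m, (right m).Finite
  left_isFO : ∀ m, ∀ φ ∈ left m, K.IsFO φ
  right_isFO : ∀ m, ∀ φ ∈ right m, K.IsFO φ
  unprovable : ∀ m, ¬ Prov C Φ (left m) (right m)
  left_max : ∀ φ, K.IsFO φ → ∃ m, φ ∈ left m ∧
    (∀ χ : FO L Ob 1, φ = .ex χ → ∃ x ∈ K.obs, FO.subst (closing fun _ => ob x) χ ∈ left m) ∨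
      Prov C Φ (insert φ (left m)) (right m)
  right_max : ∀ φ, K.IsFO φ → ∃ m, φ ∈ right m ∧
    (∀ χ : FO L Ob 1, φ = .all χ → ∃ x ∈ K.obs, FO.subst (closing fun _ => ob x) χ ∈ right m) ∨
      Prov C Φ (left m) (insert φ (right m))
  induction : ∀ (i : Fin n) (F : ∀ Q : (Φ i).defined, FO L Ob Q.1.1), (∀ Q, K.IsFO (F Q)) →
    ∀ (P : Pred L), P ∈ (Φ i).defined → ∀ v : Fin P.1 → Tm L Ob 0, (∀ j, K.IsTm (v j)) → ∃ m,
      FO.subst (closing v) (extendBot (Φ i) F P) ∈ left m ∨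
      (∃ r ∈ Φ i, ∃ y : Fin r.nv → Ob, (∀ j, y j ∈ K.obs) ∧
        minorBody (Φ i).defined (extendBot (Φ i) F) r y ∈ left m ∧
        minorHead (extendBot (Φ i) F) r y ∈ right m) ∨
      Prov C Φ (insert (.rel P.2 v) (left m)) (right m)

/-- Each task needs to be treated at only one stage: in the application, membership and, by
weakening, provability persist at later stages. -/
theorem exists_chain {S T : Type*} [Preorder S] [Countable T] (Done : T → S → S → Prop)
    (h : ∀ t s, ∃ s', s ≤ s' ∧ Done t s s') (s₀ : S) :
    ∃ c : ℕ → S, c 0 = s₀ ∧ Monotone c ∧ ∀ t, ∃ m, Done t (c m) (c (m + 1)) := by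
  choose f hf hd using h
  obtain hT | hT := isEmpty_or_nonempty T
  · exact ⟨fun _ => s₀, rfl, monotone_const, fun t => isEmptyElim t⟩
  · obtain ⟨e, he⟩ := exists_surjective_nat T
    refine ⟨fun m => Nat.rec s₀ (fun k s => f (e k) s) m, rfl,
      monotone_nat_of_le_succ fun m => hf _ _, fun t => ?_⟩
    obtain ⟨m, rfl⟩ := he t
    exact ⟨m, hd _ _⟩

theorem Defn.defined_finite {m : ℕ} (Ψ : Defn L Ob m) : Ψ.defined.Finite :=
  Ψ.finite_toSet.image Rule.pred

theorem isFO_inst {K : Fragment L Ob} {k : ℕ} {φ : FO L Ob (0 + k)} (hφ : K.IsFO φ)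
    {s : Fin k → Tm L Ob 0} (hs : ∀ i, K.IsTm (s i)) : K.IsFO (FO.subst (Sub.inst s) φ) := by
  rw [Sub.inst_eq_closing]
  exact hφ.subst fun _ => hs _

theorem isTm_inst {K : Fragment L Ob} {k : ℕ} {t : Tm L Ob (0 + k)} (ht : K.IsTm t)
    {s : Fin k → Tm L Ob 0} (hs : ∀ i, K.IsTm (s i)) : K.IsTm (t.subst (Sub.inst s)) := by
  rw [Sub.inst_eq_closing]
  exact ht.subst fun _ => hs _

variable {C : Set (FOIDFml L Ob 0)} {n : ℕ} {Φ : Fin n → Defn L Ob 0} {K : Fragment L Ob}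

/-- Finite unprovable sequents over a fragment, ordered by inclusion. -/
def UnprovableSequent (C : Set (FOIDFml L Ob 0)) {n : ℕ} (Φ : Fin n → Defn L Ob 0)
    (K : Fragment L Ob) : Type u :=
  {s : Set (FO L Ob 0) × Set (FO L Ob 0) // s.1.Finite ∧ s.2.Finite ∧ (∀ φ ∈ s.1, K.IsFO φ) ∧
    (∀ φ ∈ s.2, K.IsFO φ) ∧ ¬ Prov C Φ s.1 s.2}

instance : PartialOrder (UnprovableSequent C Φ K) :=
  inferInstanceAs (PartialOrder {_s : Set (FO L Ob 0) × Set (FO L Ob 0) // _})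

namespace UnprovableSequent

theorem exists_insert_left (s : UnprovableSequent C Φ K) {φ : FO L Ob 0} (hφ : K.IsFO φ)
    (h : ¬ Prov C Φ (insert φ s.1.1) s.1.2) :
    ∃ s' : UnprovableSequent C Φ K, s ≤ s' ∧ s'.1 = (insert φ s.1.1, s.1.2) :=
  ⟨⟨(insert φ s.1.1, s.1.2), s.2.1.insert φ, s.2.2.1,
    Set.forall_mem_insert.2 ⟨hφ, s.2.2.2.1⟩, s.2.2.2.2.1, h⟩,
    ⟨Set.subset_insert _ _, subset_rfl⟩, rfl⟩

theorem exists_insert_right (s : UnprovableSequent C Φ K) {φ : FO L Ob 0} (hφ : K.IsFO φ)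
    (h : ¬ Prov C Φ s.1.1 (insert φ s.1.2)) :
    ∃ s' : UnprovableSequent C Φ K, s ≤ s' ∧ s'.1 = (s.1.1, insert φ s.1.2) :=
  ⟨⟨(s.1.1, insert φ s.1.2), s.2.1, s.2.2.1.insert φ, s.2.2.2.1,
    Set.forall_mem_insert.2 ⟨hφ, s.2.2.2.2.1⟩, h⟩,
    ⟨subset_rfl, Set.subset_insert _ _⟩, rfl⟩

theorem exists_left (hK : K.obs.Infinite) (s : UnprovableSequent C Φ K) {φ : FO L Ob 0}
    (hφ : K.IsFO φ) : ∃ s' : UnprovableSequent C Φ K, s ≤ s' ∧ (φ ∈ s'.1.1 ∧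
      (∀ χ : FO L Ob 1, φ = .ex χ → ∃ x ∈ K.obs, FO.subst (closing fun _ => ob x) χ ∈ s'.1.1) ∨
      Prov C Φ (insert φ s.1.1) s.1.2) := by
  by_cases h : Prov C Φ (insert φ s.1.1) s.1.2
  · exact ⟨s, le_rfl, .inr h⟩
  obtain ⟨s', hs', he⟩ := s.exists_insert_left hφ h
  by_cases hex : ∃ χ : FO L Ob 1, φ = .ex χ
  · obtain ⟨χ, rfl⟩ := hex
    -- The sequent is finite and the fragment has infinitely many object symbols, so a fresh witness
    -- is available. Contraction is implicit, so the existential formula may stay on the left when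
    -- its rule is applied.
    obtain ⟨x, hxK, hx⟩ := hK.exists_notMem_finite
      ((seqFree_finite Φ s'.2.1 s'.2.2.1).union (FO.free_finite χ))
    rw [Set.mem_union, not_or] at hx
    have hex : Fml.ex χ ∈ s'.1.1 := by rw [he]; exact Set.mem_insert _ _
    obtain ⟨s'', hs'', he'⟩ := s'.exists_insert_left (φ := FO.subst (closing fun _ => ob x) χ)
      (Fragment.IsFO.subst (Fragment.isFO_ex.1 hφ) fun _ => Fragment.isTm_ob hxK) fun hp => by
        have := Prov.exL hx.1 hx.2 hp
        rw [Set.insert_eq_of_mem hex] at this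
        exact s'.2.2.2.2.2 this
    refine ⟨s'', hs'.trans hs'', .inl ⟨hs''.1 hex, ?_⟩⟩
    rintro χ' hχ
    cases hχ
    exact ⟨x, hxK, by rw [he']; exact Set.mem_insert _ _⟩
  · exact ⟨s', hs', .inl ⟨by rw [he]; exact Set.mem_insert _ _, fun χ hχ => (hex ⟨χ, hχ⟩).elim⟩⟩

theorem exists_right (hK : K.obs.Infinite) (s : UnprovableSequent C Φ K) {φ : FO L Ob 0}
    (hφ : K.IsFO φ) : ∃ s' : UnprovableSequent C Φ K, s ≤ s' ∧ (φ ∈ s'.1.2 ∧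
      (∀ χ : FO L Ob 1, φ = .all χ → ∃ x ∈ K.obs, FO.subst (closing fun _ => ob x) χ ∈ s'.1.2) ∨
      Prov C Φ s.1.1 (insert φ s.1.2)) := by
  by_cases h : Prov C Φ s.1.1 (insert φ s.1.2)
  · exact ⟨s, le_rfl, .inr h⟩
  obtain ⟨s', hs', he⟩ := s.exists_insert_right hφ h
  by_cases hall : ∃ χ : FO L Ob 1, φ = .all χ
  · obtain ⟨χ, rfl⟩ := hall
    obtain ⟨x, hxK, hx⟩ := hK.exists_notMem_finite
      ((seqFree_finite Φ s'.2.1 s'.2.2.1).union (FO.free_finite χ))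
    rw [Set.mem_union, not_or] at hx
    have hall : Fml.all χ ∈ s'.1.2 := by rw [he]; exact Set.mem_insert _ _
    obtain ⟨s'', hs'', he'⟩ := s'.exists_insert_right (φ := FO.subst (closing fun _ => ob x) χ)
      (Fragment.IsFO.subst (Fragment.isFO_all.1 hφ) fun _ => Fragment.isTm_ob hxK) fun hp => by
        have := Prov.allR hx.1 hx.2 hp
        rw [Set.insert_eq_of_mem hall] at this
        exact s'.2.2.2.2.2 this
    refine ⟨s'', hs'.trans hs'', .inl ⟨hs''.2 hall, ?_⟩⟩
    rintro χ' hχ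
    cases hχ
    exact ⟨x, hxK, by rw [he']; exact Set.mem_insert _ _⟩
  · exact ⟨s', hs', .inl ⟨by rw [he]; exact Set.mem_insert _ _,
      fun χ hχ => (hall ⟨χ, hχ⟩).elim⟩⟩

/-- If the conclusion of an induction inference is unprovable, some premise is. The formulas of that
premise are added, the major one or both formulas of a minor one. -/
theorem exists_induction (hK : K.obs.Infinite) (hΦ : ∀ i, ∀ r ∈ Φ i, K.IsRule r)
    (s : UnprovableSequent C Φ K) (i : Fin n) {F : ∀ Q : Pred L, FO L Ob Q.1}
    (hF : ∀ Q, K.IsFO (F Q)) {P : Pred L} (hP : P ∈ (Φ i).defined) {v : Fin P.1 → Tm L Ob 0}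
    (hv : ∀ j, K.IsTm (v j)) : ∃ s' : UnprovableSequent C Φ K, s ≤ s' ∧
      (FO.subst (closing v) (F P) ∈ s'.1.1 ∨
      (∃ r ∈ Φ i, ∃ y : Fin r.nv → Ob, (∀ j, y j ∈ K.obs) ∧
        minorBody (Φ i).defined F r y ∈ s'.1.1 ∧ minorHead F r y ∈ s'.1.2) ∨
      Prov C Φ (insert (.rel P.2 v) s.1.1) s.1.2) := by
  by_cases hmajor : Prov C Φ (insert (FO.subst (closing v) (F P)) s.1.1) s.1.2
  swap
  · obtain ⟨s', hs', he⟩ := s.exists_insert_left ((hF P).subst hv) hmajor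
    exact ⟨s', hs', .inl (by rw [he]; exact Set.mem_insert _ _)⟩
  have hfin : (seqFree Φ s.1.1 s.1.2 ∪ ⋃ Q ∈ (Φ i).defined, FO.free (F Q)).Finite :=
    (seqFree_finite Φ s.2.1 s.2.2.1).union
      ((Φ i).defined_finite.biUnion fun Q _ => FO.free_finite (F Q))
  have hinf := (hK.sdiff hfin).to_subtype
  let e := Infinite.natEmbedding ↥(K.obs \ (seqFree Φ s.1.1 s.1.2 ∪ ⋃ Q ∈ (Φ i).defined,
    FO.free (F Q)))
  -- One sequence of fresh symbols serves all rules, since distinctness is needed only within each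
  -- rule.
  let y : ∀ r : Rule L Ob 0, Fin r.nv → Ob := fun r j => e j
  have hyK (r : Rule L Ob 0) (j : Fin r.nv) : y r j ∈ K.obs := (e j).2.1
  by_cases hminor : ∀ r ∈ Φ i, Prov C Φ (insert (minorBody (Φ i).defined F r (y r)) s.1.1)
      (insert (minorHead F r (y r)) s.1.2)
  · refine ⟨s, le_rfl, .inr (.inr (Prov.defL i F y v hP (fun r _ => ⟨?_, fun j => ?_⟩)
      hminor hmajor))⟩
    · exact fun a b hab => Fin.ext (e.injective (Subtype.ext hab))
    · have := (e j).2.2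
      simp only [Set.mem_union, Set.mem_iUnion, not_or, not_exists] at this
      exact this
  · push Not at hminor
    obtain ⟨r, hr, h⟩ := hminor
    have hyT (j : Fin r.nv) : K.IsTm (ob (y r j) : Tm L Ob 0) := Fragment.isTm_ob (hyK r j)
    have hb : K.IsFO (minorBody (Φ i).defined F r (y r)) :=
      (isFO_inst (hΦ i r hr).body hyT).replace (fun Q _ => hF Q) _
    have hh : K.IsFO (minorHead F r (y r)) :=
      (hF _).subst fun j => isTm_inst ((hΦ i r hr).head j) hyT
    refine ⟨⟨(insert (minorBody (Φ i).defined F r (y r)) s.1.1,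
      insert (minorHead F r (y r)) s.1.2), s.2.1.insert _, s.2.2.1.insert _,
      Set.forall_mem_insert.2 ⟨hb, s.2.2.2.1⟩, Set.forall_mem_insert.2 ⟨hh, s.2.2.2.2.1⟩, h⟩,
      ⟨Set.subset_insert _ _, Set.subset_insert _ _⟩,
      .inr (.inl ⟨r, hr, y r, hyK r, Set.mem_insert _ _, Set.mem_insert _ _⟩)⟩

end UnprovableSequent

/-- Every unprovable sequent over a fragment starts a saturated chain. -/
theorem exists_saturatedChain (ho : K.obs.Infinite) (ho' : K.obs.Countable)
    (hf : K.funs.Countable) (hr : K.rels.Countable) (hΦ : ∀ i, ∀ r ∈ Φ i, K.IsRule r)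
    (s : UnprovableSequent C Φ K) :
    ∃ c : SaturatedChain C Φ K, c.left 0 = s.1.1 ∧ c.right 0 = s.1.2 := by
  have hfo (m : ℕ) : Countable {φ : FO L Ob m // K.IsFO φ} :=
    (Fragment.countable_fo ho' hf hr m).to_subtype
  have htm : Countable {t : Tm L Ob 0 // K.IsTm t} := (Fragment.countable_tm ho' hf 0).to_subtype
  have hdef (i : Fin n) : Finite (Φ i).defined := (Φ i).defined_finite.to_subtype
  -- Induction hypotheses are chosen only at the finitely many defined predicates, with `⊥`
  -- elsewhere; this keeps the type of tasks countable.
  let Task : Type u := {φ : FO L Ob 0 // K.IsFO φ} ⊕ {φ : FO L Ob 0 // K.IsFO φ} ⊕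
    Σ i : Fin n, (∀ Q : (Φ i).defined, {φ : FO L Ob Q.1.1 // K.IsFO φ}) ×
      Σ P : (Φ i).defined, Fin P.1.1 → {t : Tm L Ob 0 // K.IsTm t}
  let Done : Task → UnprovableSequent C Φ K → UnprovableSequent C Φ K → Prop
    | .inl φ, s, s' => φ.1 ∈ s'.1.1 ∧
        (∀ χ : FO L Ob 1, φ.1 = .ex χ → ∃ x ∈ K.obs,
          FO.subst (closing fun _ => ob x) χ ∈ s'.1.1) ∨ Prov C Φ (insert φ.1 s.1.1) s.1.2
    | .inr (.inl φ), s, s' => φ.1 ∈ s'.1.2 ∧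
        (∀ χ : FO L Ob 1, φ.1 = .all χ → ∃ x ∈ K.obs,
          FO.subst (closing fun _ => ob x) χ ∈ s'.1.2) ∨ Prov C Φ s.1.1 (insert φ.1 s.1.2)
    | .inr (.inr ⟨i, F, P, v⟩), s, s' =>
        FO.subst (closing fun j => (v j).1) (extendBot (Φ i) (fun Q => (F Q).1) P.1) ∈ s'.1.1 ∨
        (∃ r ∈ Φ i, ∃ y : Fin r.nv → Ob, (∀ j, y j ∈ K.obs) ∧
          minorBody (Φ i).defined (extendBot (Φ i) fun Q => (F Q).1) r y ∈ s'.1.1 ∧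
          minorHead (extendBot (Φ i) fun Q => (F Q).1) r y ∈ s'.1.2) ∨
        Prov C Φ (insert (.rel P.1.2 fun j => (v j).1) s.1.1) s.1.2
  have hDone : ∀ t s, ∃ s', s ≤ s' ∧ Done t s s' := by
    rintro (φ | φ | ⟨i, F, P, v⟩) s
    · exact s.exists_left ho φ.2
    · exact s.exists_right ho φ.2
    · refine s.exists_induction ho hΦ i (fun Q => ?_) P.2 fun j => (v j).2
      by_cases h : Q ∈ (Φ i).defined
      · simpa [extendBot, h] using (F ⟨Q, h⟩).2
      · simp [extendBot, h]
  obtain ⟨c, hc0, hc, hd⟩ := exists_chain Done hDone s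
  refine ⟨⟨fun m => (c m).1.1, fun m => (c m).1.2, fun _ _ h => (hc h).1, fun _ _ h => (hc h).2,
    fun m => (c m).2.1, fun m => (c m).2.2.1, fun m => (c m).2.2.2.1, fun m => (c m).2.2.2.2.1,
    fun m => (c m).2.2.2.2.2, fun φ hφ => ?_, fun φ hφ => ?_, fun i F hF P hP v hv => ?_⟩,
    congrArg (fun s => s.1.1) hc0, congrArg (fun s => s.1.2) hc0⟩
  · obtain ⟨m, h⟩ := hd (.inl ⟨φ, hφ⟩)
    have hm := hc m.le_succ
    exact ⟨m + 1, h.imp id fun h => h.mono (Set.insert_subset_insert hm.1) hm.2⟩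
  · obtain ⟨m, h⟩ := hd (.inr (.inl ⟨φ, hφ⟩))
    have hm := hc m.le_succ
    exact ⟨m + 1, h.imp id fun h => h.mono hm.1 (Set.insert_subset_insert hm.2)⟩
  · obtain ⟨m, h⟩ := hd (.inr (.inr ⟨i, fun Q => ⟨F Q, hF Q⟩, ⟨P, hP⟩, fun j => ⟨v j, hv j⟩⟩))
    have hm := hc m.le_succ
    exact ⟨m + 1, h.imp id (Or.imp id fun h => h.mono (Set.insert_subset_insert hm.1) hm.2)⟩

end Chains

open Filter

namespace SaturatedChain

variable {L : FirstOrder.Language.{u, u}} {Ob : Type u} {C : Set (FOIDFml L Ob 0)} {n : ℕ}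
  {Φ : Fin n → Defn L Ob 0} {K : Fragment L Ob} (c : SaturatedChain C Φ K)

/-! ### Closure properties of the limit sequent. -/

section Saturation

/-- The left side of the limit sequent. -/
def Left : Set (FO L Ob 0) := {φ | ∃ m, φ ∈ c.left m}

/-- The right side of the limit sequent. -/
def Right : Set (FO L Ob 0) := {φ | ∃ m, φ ∈ c.right m}

variable {c} {φ ψ : FO L Ob 0}

theorem eventually_left (h : φ ∈ c.Left) : ∀ᶠ m in atTop, φ ∈ c.left m := by
  obtain ⟨m, hm⟩ := h
  filter_upwards [eventually_ge_atTop m] with k hk using c.left_mono hk hm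

theorem eventually_right (h : φ ∈ c.Right) : ∀ᶠ m in atTop, φ ∈ c.right m := by
  obtain ⟨m, hm⟩ := h
  filter_upwards [eventually_ge_atTop m] with k hk using c.right_mono hk hm

theorem isFO_of_left (h : φ ∈ c.Left) : K.IsFO φ := h.elim fun m hm => c.left_isFO m φ hm

theorem isFO_of_right (h : φ ∈ c.Right) : K.IsFO φ := h.elim fun m hm => c.right_isFO m φ hm

theorem not_eventually_prov : ¬ ∀ᶠ m in atTop, Prov C Φ (c.left m) (c.right m) :=
  fun h => h.exists.elim fun m hm => c.unprovable m hm

/-- Stated with "eventually" rather than "at some stage", so that the premises of a rule can be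
combined at a common stage. -/
theorem left_or (hφ : K.IsFO φ) :
    φ ∈ c.Left ∨ ∀ᶠ m in atTop, Prov C Φ (insert φ (c.left m)) (c.right m) := by
  obtain ⟨m, h | h⟩ := c.left_max φ hφ
  · exact .inl ⟨m, h.1⟩
  · refine .inr ?_
    filter_upwards [eventually_ge_atTop m] with k hk
      using h.mono (Set.insert_subset_insert (c.left_mono hk)) (c.right_mono hk)

theorem right_or (hφ : K.IsFO φ) :
    φ ∈ c.Right ∨ ∀ᶠ m in atTop, Prov C Φ (c.left m) (insert φ (c.right m)) := by
  obtain ⟨m, h | h⟩ := c.right_max φ hφ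
  · exact .inl ⟨m, h.1⟩
  · refine .inr ?_
    filter_upwards [eventually_ge_atTop m] with k hk
      using h.mono (c.left_mono hk) (Set.insert_subset_insert (c.right_mono hk))

theorem notMem_of_eventually_left
    (h : ∀ᶠ m in atTop, Prov C Φ (insert φ (c.left m)) (c.right m)) : φ ∉ c.Left := fun hφ => by
  refine not_eventually_prov (c := c) ?_
  filter_upwards [h, eventually_left hφ] with m hm hφ
  rwa [Set.insert_eq_of_mem hφ] at hm

theorem notMem_of_eventually_right
    (h : ∀ᶠ m in atTop, Prov C Φ (c.left m) (insert φ (c.right m))) : φ ∉ c.Right := fun hφ => by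
  refine not_eventually_prov (c := c) ?_
  filter_upwards [h, eventually_right hφ] with m hm hφ
  rwa [Set.insert_eq_of_mem hφ] at hm

theorem notMem_right (h : φ ∈ c.Left) : φ ∉ c.Right := fun h' => by
  refine not_eventually_prov (c := c) ?_
  filter_upwards [eventually_left h, eventually_right h'] with m hm hm' using Prov.ax hm hm'

theorem bot_notMem_left : Fml.bot ∉ c.Left := fun h => by
  refine not_eventually_prov (c := c) ?_
  filter_upwards [eventually_left h] with m hm using Prov.botL hm

theorem top_notMem_right : Fml.top ∉ c.Right := fun h => by
  refine not_eventually_prov (c := c) ?_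
  filter_upwards [eventually_right h] with m hm using Prov.topR hm

/-- The pattern for all connectives: if the required components were absent, the premises of the
introduction rule would be provable from some stage on, hence also the conclusion, whose principal
formula is already in the sequent. -/
theorem of_neg_left (h : .neg φ ∈ c.Left) : φ ∈ c.Right := by
  refine (right_or (Fragment.isFO_neg.1 (isFO_of_left h))).resolve_right fun h' => ?_
  refine notMem_of_eventually_left ?_ h
  filter_upwards [h'] with m hm using Prov.negL hm

theorem of_neg_right (h : .neg φ ∈ c.Right) : φ ∈ c.Left := by
  refine (left_or (Fragment.isFO_neg.1 (isFO_of_right h))).resolve_right fun h' => ?_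
  refine notMem_of_eventually_right ?_ h
  filter_upwards [h'] with m hm using Prov.negR hm

theorem of_and_left (h : .and φ ψ ∈ c.Left) : φ ∈ c.Left ∧ ψ ∈ c.Left := by
  have hf := Fragment.isFO_and.1 (isFO_of_left h)
  constructor
  · refine (left_or hf.1).resolve_right fun h' => notMem_of_eventually_left ?_ h
    filter_upwards [h'] with m hm using Prov.andL (hm.mono (by grind) subset_rfl)
  · refine (left_or hf.2).resolve_right fun h' => notMem_of_eventually_left ?_ h
    filter_upwards [h'] with m hm using Prov.andL (hm.mono (by grind) subset_rfl)

theorem of_and_right (h : .and φ ψ ∈ c.Right) : φ ∈ c.Right ∨ ψ ∈ c.Right := by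
  have hf := Fragment.isFO_and.1 (isFO_of_right h)
  refine (right_or hf.1).imp_right fun h' => (right_or hf.2).resolve_right fun h'' => ?_
  refine notMem_of_eventually_right ?_ h
  filter_upwards [h', h''] with m hm hm' using Prov.andR hm hm'

theorem of_or_left (h : .or φ ψ ∈ c.Left) : φ ∈ c.Left ∨ ψ ∈ c.Left := by
  have hf := Fragment.isFO_or.1 (isFO_of_left h)
  refine (left_or hf.1).imp_right fun h' => (left_or hf.2).resolve_right fun h'' => ?_
  refine notMem_of_eventually_left ?_ h
  filter_upwards [h', h''] with m hm hm' using Prov.orL hm hm'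

theorem of_or_right (h : .or φ ψ ∈ c.Right) : φ ∈ c.Right ∧ ψ ∈ c.Right := by
  have hf := Fragment.isFO_or.1 (isFO_of_right h)
  constructor
  · refine (right_or hf.1).resolve_right fun h' => notMem_of_eventually_right ?_ h
    filter_upwards [h'] with m hm using Prov.orR (hm.mono subset_rfl (by grind))
  · refine (right_or hf.2).resolve_right fun h' => notMem_of_eventually_right ?_ h
    filter_upwards [h'] with m hm using Prov.orR (hm.mono subset_rfl (by grind))

theorem of_imp_left (h : .imp φ ψ ∈ c.Left) : φ ∈ c.Right ∨ ψ ∈ c.Left := by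
  have hf := Fragment.isFO_imp.1 (isFO_of_left h)
  refine (right_or hf.1).imp_right fun h' => (left_or hf.2).resolve_right fun h'' => ?_
  refine notMem_of_eventually_left ?_ h
  filter_upwards [h', h''] with m hm hm' using Prov.impL hm hm'

theorem of_imp_right (h : .imp φ ψ ∈ c.Right) : φ ∈ c.Left ∧ ψ ∈ c.Right := by
  have hf := Fragment.isFO_imp.1 (isFO_of_right h)
  constructor
  · refine (left_or hf.1).resolve_right fun h' => notMem_of_eventually_right ?_ h
    filter_upwards [h'] with m hm using Prov.impR (hm.mono subset_rfl (by grind))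
  · refine (right_or hf.2).resolve_right fun h' => notMem_of_eventually_right ?_ h
    filter_upwards [h'] with m hm using Prov.impR (hm.mono (by grind) subset_rfl)

theorem of_iff_left (h : .iff φ ψ ∈ c.Left) :
    (φ ∈ c.Right ∧ ψ ∈ c.Right) ∨ (φ ∈ c.Left ∧ ψ ∈ c.Left) := by
  have hf := Fragment.isFO_iff.1 (isFO_of_left h)
  by_contra! hc
  have hr : ∀ᶠ m in atTop, Prov C Φ (c.left m) (insert φ (insert ψ (c.right m))) := by
    rcases right_or hf.1 with h1 | h1
    · filter_upwards [(right_or hf.2).resolve_left (hc.1 h1)] with m hm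
        using hm.mono subset_rfl (by grind)
    · filter_upwards [h1] with m hm using hm.mono subset_rfl (by grind)
  have hl : ∀ᶠ m in atTop, Prov C Φ (insert φ (insert ψ (c.left m))) (c.right m) := by
    rcases left_or hf.1 with h1 | h1
    · filter_upwards [(left_or hf.2).resolve_left (hc.2 h1)] with m hm
        using hm.mono (by grind) subset_rfl
    · filter_upwards [h1] with m hm using hm.mono (by grind) subset_rfl
  refine notMem_of_eventually_left ?_ h
  filter_upwards [hr, hl] with m hm hm' using Prov.iffL hm hm'

theorem of_iff_right (h : .iff φ ψ ∈ c.Right) :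
    (φ ∈ c.Left ∧ ψ ∈ c.Right) ∨ (ψ ∈ c.Left ∧ φ ∈ c.Right) := by
  have key {φ ψ : FO L Ob 0} (hφ : K.IsFO φ) (hψ : K.IsFO ψ) (hc : φ ∈ c.Left → ψ ∉ c.Right) :
      ∀ᶠ m in atTop, Prov C Φ (insert φ (c.left m)) (insert ψ (c.right m)) := by
    rcases left_or hφ with h1 | h1
    · filter_upwards [(right_or hψ).resolve_left (hc h1)] with m hm
        using hm.mono (by grind) subset_rfl
    · filter_upwards [h1] with m hm using hm.mono subset_rfl (by grind)
  have hf := Fragment.isFO_iff.1 (isFO_of_right h)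
  by_contra! hc
  refine notMem_of_eventually_right ?_ h
  filter_upwards [key hf.1 hf.2 hc.1, key hf.2 hf.1 hc.2] with m hm hm' using Prov.iffR hm hm'

theorem of_all_left {φ : FO L Ob 1} (h : .all φ ∈ c.Left) {t : Tm L Ob 0} (ht : K.IsTm t) :
    FO.subst (closing fun _ => t) φ ∈ c.Left := by
  have hf : K.IsFO φ := Fragment.isFO_all.1 (isFO_of_left h)
  refine (left_or (hf.subst fun _ => ht)).resolve_right fun h' => notMem_of_eventually_left ?_ h
  filter_upwards [h'] with m hm using Prov.allL t hm

theorem of_ex_right {φ : FO L Ob 1} (h : .ex φ ∈ c.Right) {t : Tm L Ob 0} (ht : K.IsTm t) :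
    FO.subst (closing fun _ => t) φ ∈ c.Right := by
  have hf : K.IsFO φ := Fragment.isFO_ex.1 (isFO_of_right h)
  refine (right_or (hf.subst fun _ => ht)).resolve_right fun h' =>
    notMem_of_eventually_right ?_ h
  filter_upwards [h'] with m hm using Prov.exR t hm

theorem of_ex_left {φ : FO L Ob 1} (h : .ex φ ∈ c.Left) :
    ∃ t, K.IsTm t ∧ FO.subst (closing fun _ => t) φ ∈ c.Left := by
  -- The chain itself is consulted, since `left_or` forgets the witness added together with the
  -- formula.
  obtain ⟨m, h' | h'⟩ := c.left_max _ (isFO_of_left h)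
  · obtain ⟨x, hx, hm⟩ := h'.2 φ rfl
    exact ⟨ob x, Fragment.isTm_ob hx, m, hm⟩
  · refine (notMem_of_eventually_left ?_ h).elim
    filter_upwards [eventually_ge_atTop m] with k hk
      using h'.mono (Set.insert_subset_insert (c.left_mono hk)) (c.right_mono hk)

theorem of_all_right {φ : FO L Ob 1} (h : .all φ ∈ c.Right) :
    ∃ t, K.IsTm t ∧ FO.subst (closing fun _ => t) φ ∈ c.Right := by
  obtain ⟨m, h' | h'⟩ := c.right_max _ (isFO_of_right h)
  · obtain ⟨x, hx, hm⟩ := h'.2 φ rfl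
    exact ⟨ob x, Fragment.isTm_ob hx, m, hm⟩
  · refine (notMem_of_eventually_right ?_ h).elim
    filter_upwards [eventually_ge_atTop m] with k hk
      using h'.mono (c.left_mono hk) (Set.insert_subset_insert (c.right_mono hk))

theorem of_alls_left {k : ℕ} {φ : FO L Ob k} (h : Fml.alls φ ∈ c.Left) {t : Fin k → Tm L Ob 0}
    (ht : ∀ i, K.IsTm (t i)) : FO.subst (closing t) φ ∈ c.Left := by
  induction k with
  | zero => rwa [show closing t = Sub.ident 0 from congrArg _ (Subsingleton.elim _ _), FO.subst_id]
  | succ k ih =>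
    have h' := of_all_left (ih h fun i => ht i.castSucc) (ht (Fin.last k))
    rw [← Fin.snoc_init_self t, ← FO.subst_closing_lift]
    exact h'

theorem of_alls_right {k : ℕ} {φ : FO L Ob k} (h : Fml.alls φ ∈ c.Right) :
    ∃ t : Fin k → Tm L Ob 0, FO.subst (closing t) φ ∈ c.Right := by
  induction k with
  | zero => exact ⟨Fin.elim0, by
      rwa [show closing Fin.elim0 = Sub.ident 0 from congrArg _ (Subsingleton.elim _ _),
        FO.subst_id]⟩
  | succ k ih =>
    obtain ⟨t, ht⟩ := ih h
    obtain ⟨u, -, hu⟩ := of_all_right (φ := FO.subst (closing t).lift φ) ht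
    exact ⟨_, by rwa [FO.subst_closing_lift] at hu⟩

/-- Elementary cuts decide the atoms of a predicate symbol. -/
theorem atom_left_or_right {Q : Pred L} (hQ : FO.toID (excludedMiddle Q) ∈ C) (hK : Q ∈ K.rels)
    {t : Fin Q.1 → Tm L Ob 0} (ht : ∀ i, K.IsTm (t i)) :
    .rel Q.2 t ∈ c.Left ∨ .rel Q.2 t ∈ c.Right := by
  have hf : K.IsFO (excludedMiddle Q : FO L Ob 0) :=
    Fragment.isFO_alls (by simp [hK, Fragment.isTm_bv])
  -- On the right, excluded middle would put some instance of `Q` on both sides. So adding it on the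
  -- right gives provable sequents; were it also absent from the left, a cut would prove a sequent
  -- of the chain.
  have hr : excludedMiddle Q ∉ c.Right := fun h => by
    obtain ⟨s, hs⟩ := of_alls_right h
    have hs := of_or_right hs
    exact notMem_right (of_neg_right hs.2) hs.1
  have hl : excludedMiddle Q ∈ c.Left := by
    refine (left_or hf).resolve_right fun h => not_eventually_prov (c := c) ?_
    filter_upwards [(right_or hf).resolve_left hr, h] with m hm hm' using Prov.cut hQ hm hm'
  exact (of_or_left (of_alls_left hl ht)).imp id of_neg_left

end Saturation

end SaturatedChain

open Filter

namespace SaturatedChain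

variable {L : FirstOrder.Language.{u, u}} {Ob : Type u} {C : Set (FOIDFml L Ob 0)} {n : ℕ}
  {Φ : Fin n → Defn L Ob 0} {K : Fragment L Ob} (c : SaturatedChain C Φ K)

/-! ### The domain: terms modulo Leibniz equality. -/

section Equality

/-- The sequents of the chain become provable when `φ` is added on the right. -/
def Derives (φ : FO L Ob 0) : Prop :=
  ∀ᶠ m in atTop, Prov C Φ (c.left m) (insert φ (c.right m))

/-- Leibniz equality of terms. -/
def leibniz : Setoid (Tm L Ob 0) where
  r t s := ∀ A : FO L Ob 1, c.Derives (FO.subst (closing fun _ => K.tm t) A) ↔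
    c.Derives (FO.subst (closing fun _ => K.tm s) A)
  iseqv := ⟨fun _ _ => Iff.rfl, fun h A => (h A).symm, fun h h' A => (h A).trans (h' A)⟩

/-- The domain of the term model. -/
def Dom : Type u := Quotient c.leibniz

/-- The element of the term model denoted by a term. -/
def cls (t : Tm L Ob 0) : c.Dom := Quotient.mk c.leibniz t

variable {c}

theorem cls_eq_cls {t s : Tm L Ob 0} : c.cls t = c.cls s ↔
    ∀ A : FO L Ob 1, c.Derives (FO.subst (closing fun _ => K.tm t) A) ↔
      c.Derives (FO.subst (closing fun _ => K.tm s) A) :=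
  Quotient.eq

/-- Leibniz equality looks only at retracts, so every class contains a term of the fragment. -/
theorem cls_tm (t : Tm L Ob 0) : c.cls (K.tm t) = c.cls t :=
  cls_eq_cls.2 fun A => by rw [Fragment.tm_tm]

theorem exists_isTm (a : c.Dom) : ∃ t, K.IsTm t ∧ c.cls t = a := by
  obtain ⟨t, rfl⟩ := Quotient.exists_rep a
  exact ⟨K.tm t, Fragment.tm_tm t, cls_tm t⟩

theorem exists_isTm_fun {k : ℕ} (a : Fin k → c.Dom) :
    ∃ t : Fin k → Tm L Ob 0, (∀ i, K.IsTm (t i)) ∧ (fun i => c.cls (t i)) = a := by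
  choose t ht hta using fun i => exists_isTm (a i)
  exact ⟨t, ht, funext hta⟩

/-- The definition gives replacement in one place; several arguments are exchanged one at a time,
the mixed tuples being `Finset.piecewise`. -/
theorem derives_congr {k : ℕ} {t s : Fin k → Tm L Ob 0} (h : ∀ i, c.cls (t i) = c.cls (s i))
    (A : FO L Ob k) : c.Derives (FO.subst (closing fun i => K.tm (t i)) A) ↔
      c.Derives (FO.subst (closing fun i => K.tm (s i)) A) := by
  have single (w : Fin k → Tm L Ob 0) (j : Fin k) (u : Tm L Ob 0) :
      FO.subst (closing fun _ => u) (FO.subst (Sum.elim ob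
        (Function.update (fun i => (w i).relabel (Sum.map id Fin.castSucc)) j (bv 0))) A) =
      FO.subst (closing (Function.update w j u)) A := by
    rw [FO.subst_subst, closing_comp_closing]
    congr 2
    funext i
    by_cases hi : i = j
    · subst hi; simp [FirstOrder.Language.Term.subst]
    · simp only [Function.update_of_ne hi]
      exact tm_relabel_subst_closing _ _
  have piecewise (S : Finset (Fin k)) :
      c.Derives (FO.subst (closing fun i => K.tm (t i)) A) ↔
        c.Derives (FO.subst (closing (S.piecewise (fun i => K.tm (s i)) fun i => K.tm (t i))) A) := by
    induction S using Finset.induction_on with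
    | empty => simp
    | insert j S hj ih =>
      refine ih.trans ?_
      rw [Finset.piecewise_insert, ← single, ← cls_eq_cls.1 (h j), single]
      rw [Function.update_eq_self_iff.2]
      simp [hj]
  simpa using piecewise Finset.univ

theorem cls_eq_of_left [Infinite Ob] {t s : Tm L Ob 0} (h : .eq t s ∈ c.Left) :
    c.cls t = c.cls s := by
  have hf := Fragment.isFO_eq.1 (isFO_of_left h)
  refine cls_eq_cls.2 fun A => ?_
  rw [hf.1, hf.2]
  constructor <;> intro hA
  · filter_upwards [hA, eventually_left h] with m hm hm'
    have := (Prov.eqL (t := s) (c.left_finite m) (c.right_finite m) A hm).2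
    rwa [Set.insert_eq_of_mem hm'] at this
  · filter_upwards [hA, eventually_left h] with m hm hm'
    have := (Prov.eqL (t := t) (c.left_finite m) (c.right_finite m) A hm).1
    rwa [Set.insert_eq_of_mem hm'] at this

/-- Leibniz's argument with the formula `z = s`: it is derivable for `s` by reflexivity, hence for
any term identified with `s`. -/
theorem cls_ne_of_right {t s : Tm L Ob 0} (h : .eq t s ∈ c.Right) : c.cls t ≠ c.cls s := fun he => by
  have hf := Fragment.isFO_eq.1 (isFO_of_right h)
  have inst (u : Tm L Ob 0) : FO.subst (closing fun _ => u)
      (.eq (bv 0) (s.relabel (Sum.map id Fin.castSucc)) : FO L Ob 1) = .eq u s :=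
    congrArg (Fml.eq u) (tm_relabel_subst_closing s _)
  have := cls_eq_cls.1 he (.eq (bv 0) (s.relabel (Sum.map id Fin.castSucc)))
  rw [inst, inst, hf.1, hf.2] at this
  exact notMem_of_eventually_right (this.2 (Eventually.of_forall fun m => Prov.eqR s)) h

theorem derives_rel_congr {P : Pred L} {t s : Fin P.1 → Tm L Ob 0}
    (ht : ∀ i, K.IsTm (t i)) (hs : ∀ i, K.IsTm (s i)) (h : ∀ i, c.cls (t i) = c.cls (s i))
    (hd : c.Derives (.rel P.2 t)) : c.Derives (.rel P.2 s) := by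
  have := derives_congr h (.rel P.2 bv)
  simp only [FO.subst, Fml.substWith, FirstOrder.Language.Term.subst, Sum.elim_inr] at this
  rw [show (fun i => K.tm (t i)) = t from funext ht,
    show (fun i => K.tm (s i)) = s from funext hs] at this
  exact this.1 hd

theorem isTm_of_rel_left {P : Pred L} {t : Fin P.1 → Tm L Ob 0} (h : .rel P.2 t ∈ c.Left) :
    ∀ i, K.IsTm (t i) := (Fragment.isFO_rel.1 (isFO_of_left h)).2

theorem isTm_of_rel_right {P : Pred L} {t : Fin P.1 → Tm L Ob 0} (h : .rel P.2 t ∈ c.Right) :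
    ∀ i, K.IsTm (t i) := (Fragment.isFO_rel.1 (isFO_of_right h)).2

/-- An atom on the left is derivable by the axiom, and derivability is invariant under Leibniz
equality. So the two sides never conflict on classes. -/
theorem rel_notMem_right {P : Pred L} {t s : Fin P.1 → Tm L Ob 0} (h : .rel P.2 t ∈ c.Left)
    (he : ∀ i, c.cls (t i) = c.cls (s i)) : .rel P.2 s ∉ c.Right := fun h' => by
  refine notMem_of_eventually_right (c := c) (derives_rel_congr (isTm_of_rel_left h)
    (isTm_of_rel_right h') he ?_) h'
  filter_upwards [eventually_left h] with m hm using Prov.ax hm (Set.mem_insert _ _)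

end Equality

/-! ### The term model, the truth lemma and the choice of the predicates. -/

section Model

/-- The term model, with empty predicates. -/
noncomputable instance : L.Structure c.Dom where
  funMap f a := c.cls (.func f fun i => (a i).out)
  RelMap _ _ := False

/-- The interpretation of the object symbols in the term model. -/
def val (x : Ob) : c.Dom := c.cls (ob x)

variable {c}

/-- For `f` in the fragment, congruence is applied to the formulas `A(f(…))`; for other `f`, all
values collapse to the class of the base symbol. -/
theorem cls_func {k : ℕ} (f : L.Functions k) (t : Fin k → Tm L Ob 0) :
    FirstOrder.Language.Structure.funMap f (fun i => c.cls (t i)) = c.cls (.func f t) := by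
  have hout (i : Fin k) : c.cls (c.cls (t i)).out = c.cls (t i) := Quotient.out_eq _
  refine cls_eq_cls.2 fun A => ?_
  by_cases hf : (⟨k, f⟩ : Σ k, L.Functions k) ∈ K.funs
  · have := derives_congr hout (FO.subst (Sum.elim ob fun _ => .func f bv) A)
    simp only [FO.subst_subst, closing_comp_closing, FirstOrder.Language.Term.subst,
      Sum.elim_inr] at this
    simpa only [Fragment.tm, hf, if_true] using this
  · simp only [Fragment.tm, hf, if_false]

theorem realize_eq_cls {k : ℕ} (t : Tm L Ob k) (s : Fin k → Tm L Ob 0) :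
    t.realize (Sum.elim c.val fun i => c.cls (s i)) = c.cls (t.subst (closing s)) := by
  induction t with
  | var z => rcases z with x | i <;> rfl
  | func f ts ih =>
    simp only [FirstOrder.Language.Term.realize, FirstOrder.Language.Term.subst, ih]
    exact cls_func f _

/-- The truth lemma. -/
theorem truth [Infinite Ob] {M : PredInterp L c.Dom}
    (hl : ∀ (P : Pred L) (t : Fin P.1 → Tm L Ob 0), .rel P.2 t ∈ c.Left →
      (fun i => c.cls (t i)) ∈ M P)
    (hr : ∀ (P : Pred L) (t : Fin P.1 → Tm L Ob 0), .rel P.2 t ∈ c.Right →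
      (fun i => c.cls (t i)) ∉ M P)
    {k : ℕ} (φ : FO L Ob k) (t : Fin k → Tm L Ob 0) :
    (FO.subst (closing t) φ ∈ c.Left → FO.Holds c.val M M φ fun i => c.cls (t i)) ∧
    (FO.subst (closing t) φ ∈ c.Right → ¬ FO.Holds c.val M M φ fun i => c.cls (t i)) := by
  have snoc {k : ℕ} (t : Fin k → Tm L Ob 0) (u : Tm L Ob 0) :
      (Fin.snoc (fun i => c.cls (t i)) (c.cls u) : Fin (k + 1) → c.Dom) =
        fun i => c.cls ((Fin.snoc t u : Fin (k + 1) → Tm L Ob 0) i) := by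
    funext i
    induction i using Fin.lastCases <;> simp
  induction φ with
  | ext a => exact a.elim
  | top => exact ⟨fun _ => trivial, fun h => (top_notMem_right h).elim⟩
  | bot => exact ⟨fun h => (bot_notMem_left h).elim, fun _ h => h⟩
  | eq s s' =>
    simp only [Fml.Holds, realize_eq_cls]
    exact ⟨cls_eq_of_left, cls_ne_of_right⟩
  | rel R ts =>
    simp only [Fml.Holds, realize_eq_cls]
    exact ⟨hl ⟨_, R⟩ _, hr ⟨_, R⟩ _⟩
  | neg φ ih =>
    exact ⟨fun h => (ih t).2 (of_neg_left h), fun h h' => h' ((ih t).1 (of_neg_right h))⟩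
  | and φ ψ ih ih' =>
    exact ⟨fun h => (of_and_left h).imp (ih t).1 (ih' t).1,
      fun h h' => (of_and_right h).elim (fun h => (ih t).2 h h'.1) fun h => (ih' t).2 h h'.2⟩
  | or φ ψ ih ih' =>
    exact ⟨fun h => (of_or_left h).imp (ih t).1 (ih' t).1,
      fun h h' => h'.elim ((ih t).2 (of_or_right h).1) ((ih' t).2 (of_or_right h).2)⟩
  | imp φ ψ ih ih' =>
    exact ⟨fun h h' => (of_imp_left h).elim (fun h => ((ih t).2 h h').elim) (ih' t).1,
      fun h h' => (ih' t).2 (of_imp_right h).2 (h' ((ih t).1 (of_imp_right h).1))⟩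
  | iff φ ψ ih ih' =>
    refine ⟨fun h => ?_, fun h h' => ?_⟩
    · rcases of_iff_left h with h | h
      · exact ⟨fun h' => ((ih t).2 h.1 h').elim, fun h' => ((ih' t).2 h.2 h').elim⟩
      · exact ⟨fun _ => (ih' t).1 h.2, fun _ => (ih t).1 h.1⟩
    · rcases of_iff_right h with h | h
      · exact (ih' t).2 h.2 (h'.1 ((ih t).1 h.1))
      · exact (ih t).2 h.2 (h'.2 ((ih' t).1 h.1))
  | all φ ih =>
    refine ⟨fun h a => ?_, fun h h' => ?_⟩
    · obtain ⟨u, hu, rfl⟩ := exists_isTm a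
      rw [snoc]
      refine (ih _).1 ?_
      rw [← FO.subst_closing_lift]
      exact of_all_left h hu
    · obtain ⟨u, -, hu⟩ := of_all_right h
      refine (ih (Fin.snoc (α := fun _ => Tm L Ob 0) t u)).2 ?_ ?_
      · rw [← FO.subst_closing_lift]
        exact hu
      · rw [← snoc]
        exact h' _
  | ex φ ih =>
    refine ⟨fun h => ?_, fun h => ?_⟩
    · obtain ⟨u, -, hu⟩ := of_ex_left h
      refine ⟨c.cls u, ?_⟩
      rw [snoc]
      refine (ih _).1 ?_
      rw [← FO.subst_closing_lift]
      exact hu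
    · rintro ⟨a, ha⟩
      obtain ⟨u, hu, rfl⟩ := exists_isTm a
      rw [snoc] at ha
      refine (ih _).2 ?_ ha
      rw [← FO.subst_closing_lift]
      exact of_ex_right h hu

variable (c)

/-- The largest interpretation that makes all atoms on the right false. -/
def maxPreds : PredInterp L c.Dom :=
  fun P => {a | ∀ t : Fin P.1 → Tm L Ob 0, (fun i => c.cls (t i)) = a → .rel P.2 t ∉ c.Right}

/-- Interpretations that make all atoms on the left true and are closed under the rules, where
negative occurrences are interpreted by `maxPreds`. -/
structure IsClosedInterp (J : PredInterp L c.Dom) : Prop where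
  left : ∀ (P : Pred L) (t : Fin P.1 → Tm L Ob 0), .rel P.2 t ∈ c.Left →
    (fun i => c.cls (t i)) ∈ J P
  op : ∀ i P, (Φ i).op c.val Fin.elim0 J c.maxPreds P ⊆ J P

/-- The interpretation of the predicates in the term model: the least closed one. -/
def preds : PredInterp L c.Dom := fun P => {a | ∀ J, c.IsClosedInterp J → a ∈ J P}

variable {c}

theorem preds_subset {J : PredInterp L c.Dom} (hJ : c.IsClosedInterp J) (P : Pred L) :
    c.preds P ⊆ J P := fun _ ha => ha J hJ

/-- With negative occurrences fixed, the operators are monotone, so closed interpretations are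
stable under intersection. -/
theorem isClosedInterp_preds : c.IsClosedInterp c.preds where
  left P t h _ hJ := hJ.left P t h
  op i P _ ha _ hJ := hJ.op i P (Defn.op_mono (preds_subset hJ) P ha)

theorem append_elim0 {D : Type*} {k : ℕ} (b : Fin k → D) :
    Fin.append Fin.elim0 b = fun i => b (Fin.cast (zero_add k) i) := by
  rw [Fin.elim0_append]
  rfl

/-- A body true in `maxPreds` is not on the right, hence it is derivable; (def R) then makes the
head derivable, and no atom equal to it modulo classes can be on the right. -/
theorem isClosedInterp_maxPreds [Infinite Ob] (hΦ : ∀ i, ∀ r ∈ Φ i, K.IsRule r) :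
    c.IsClosedInterp c.maxPreds := by
  have hl (P : Pred L) (t : Fin P.1 → Tm L Ob 0) (h : .rel P.2 t ∈ c.Left) :
      (fun i => c.cls (t i)) ∈ c.maxPreds P :=
    fun s hs => rel_notMem_right h fun i => (congrFun hs i).symm
  refine ⟨hl, ?_⟩
  rintro i P a ⟨r, hr, b, hb, hold⟩ t hta ht
  cases hb
  obtain ⟨s, hs, rfl⟩ := exists_isTm_fun b
  rw [append_elim0] at hold hta
  have hbody : c.Derives (FO.subst (Sub.inst s) r.body) := by
    refine (right_or (isFO_inst (hΦ i r hr).body hs)).resolve_left fun h => ?_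
    rw [Sub.inst_eq_closing] at h
    -- The truth lemma is applied to `maxPreds` itself, which contains the left atoms and omits the
    -- right ones.
    exact (truth hl (fun P t ht h => h t rfl ht) r.body _).2 h hold
  have hhead : c.Derives (.rel r.pred.2 fun j => (r.head j).subst (Sub.inst s)) := by
    filter_upwards [hbody] with m hm using Prov.defR i hr s hm
  refine notMem_of_eventually_right (derives_rel_congr
    (fun j => isTm_inst ((hΦ i r hr).head j) hs) (isTm_of_rel_right ht) (fun j => ?_) hhead) ht
  rw [Sub.inst_eq_closing, ← realize_eq_cls]
  exact (congrFun hta j).symm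

end Model

end SaturatedChain

/-! ### Definable relations and the Henkin model property. -/

namespace SaturatedChain

variable {L : FirstOrder.Language.{u, u}} {Ob : Type u} {C : Set (FOIDFml L Ob 0)} {n : ℕ}
  {Φ : Fin n → Defn L Ob 0} {K : Fragment L Ob} (c : SaturatedChain C Φ K)

/-- The relations on the term model that are definable by FO-formulas. -/
def definable (k : ℕ) : Set (Set (Fin k → c.Dom)) :=
  {R | ∃ F : FO L Ob k, ∀ a, a ∈ R ↔ FO.Holds c.val c.preds c.preds F a}

/-- The term model. -/
noncomputable abbrev model : L.Structure c.Dom := withPreds inferInstance c.preds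

variable {c}

theorem realize_weaken {k : ℕ} (t : Tm L Ob 0) (e : Fin k → c.Dom) :
    (t.relabel (Sum.map id Fin.elim0) : Tm L Ob k).realize (Sum.elim c.val e) = c.cls t := by
  rw [FirstOrder.Language.Term.realize_relabel]
  have h : Sum.elim c.val e ∘ Sum.map id Fin.elim0 =
      Sum.elim c.val fun i : Fin 0 => c.cls (bv i) := by
    funext z
    rcases z with x | i
    · rfl
    · exact i.elim0
  rw [h, realize_eq_cls]
  exact congrArg c.cls (tm_subst_id t)

/-- Every element of the domain is the value of a term, so parameters can be substituted into
defining formulas and definability without parameters suffices. -/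
theorem isHenkinClass_definable : @IsHenkinClass L c.Dom c.model c.definable := by
  refine @IsHenkinClass.mk L c.Dom c.model c.definable ?_ ?_ ?_ ?_ ?_ ?_ ?_
  · exact ⟨.eq (bv 0) (bv 1), fun a => Iff.rfl⟩
  · exact fun P => ⟨.rel P.2 bv, fun a => Iff.rfl⟩
  · rintro k R a ⟨F, hF⟩
    obtain ⟨t, -, rfl⟩ := exists_isTm a
    refine ⟨FO.subst (Sum.elim ob (Fin.snoc (α := fun _ => Tm L Ob k) bv
      (t.relabel (Sum.map id Fin.elim0)))) F, fun b => ?_⟩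
    rw [FO.holds_subst, ← hF]
    refine iff_of_eq (congrArg (· ∈ R) (funext fun i => ?_))
    induction i using Fin.lastCases with
    | last => simp only [Fin.snoc_last, realize_weaken]
    | cast i => simp
  · rintro k m l R t b ⟨F, hF⟩
    obtain ⟨s, -, rfl⟩ := exists_isTm_fun b
    refine ⟨FO.subst (Sum.elim ob fun i => (t i).subst
      (Sum.elim bv fun j => (s j).relabel (Sum.map id Fin.elim0))) F, fun a => ?_⟩
    rw [FO.holds_subst, ← hF]
    refine iff_of_eq (congrArg (· ∈ R) (funext fun i => ?_))
    rw [FirstOrder.Language.Term.realize_subst, realize_withPreds]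
    congr 1
    funext z
    rcases z with i | j
    · rfl
    · exact (realize_weaken (s j) a).symm
  · rintro k R ⟨F, hF⟩
    exact ⟨.neg F, fun a => not_congr (hF a)⟩
  · rintro k R S ⟨F, hF⟩ ⟨G, hG⟩
    exact ⟨.and F G, fun a => and_congr (hF a) (hG a)⟩
  · rintro k R ⟨F, hF⟩
    exact ⟨.all F, fun b => forall_congr' fun a => hF _⟩

/-- The effect of the elementary cuts: an atom that is not on the right is on the left, so the gap
between the two interpretations closes at `Q`. -/
theorem preds_eq_maxPreds [Infinite Ob] (hΦ : ∀ i, ∀ r ∈ Φ i, K.IsRule r) {Q : Pred L}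
    (hQ : FO.toID (excludedMiddle Q) ∈ C) (hK : Q ∈ K.rels) : c.preds Q = c.maxPreds Q := by
  refine (preds_subset (isClosedInterp_maxPreds hΦ) Q).antisymm fun a ha => ?_
  obtain ⟨t, ht, rfl⟩ := exists_isTm_fun a
  exact isClosedInterp_preds.left Q t ((atom_left_or_right hQ hK ht).resolve_right (ha t rfl))

theorem truth_preds [Infinite Ob] (hΦ : ∀ i, ∀ r ∈ Φ i, K.IsRule r) {k : ℕ} (φ : FO L Ob k)
    (t : Fin k → Tm L Ob 0) :
    (FO.subst (closing t) φ ∈ c.Left → FO.Holds c.val c.preds c.preds φ fun i => c.cls (t i)) ∧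
    (FO.subst (closing t) φ ∈ c.Right →
      ¬ FO.Holds c.val c.preds c.preds φ fun i => c.cls (t i)) :=
  truth isClosedInterp_preds.left
    (fun P t h h' => preds_subset (isClosedInterp_maxPreds hΦ) P h' t rfl h) φ t

theorem truth_sentence [Infinite Ob] (hΦ : ∀ i, ∀ r ∈ Φ i, K.IsRule r) (φ : FO L Ob 0) :
    (φ ∈ c.Left → FO.Holds c.val c.preds c.preds φ Fin.elim0) ∧
    (φ ∈ c.Right → ¬ FO.Holds c.val c.preds c.preds φ Fin.elim0) := by
  have h := truth_preds (c := c) hΦ φ Fin.elim0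
  rwa [show closing Fin.elim0 = Sub.ident 0 from congrArg _ (Subsingleton.elim _ _), FO.subst_id,
    show (fun i => c.cls (Fin.elim0 i)) = Fin.elim0 from Subsingleton.elim _ _] at h

/-- Definability refers to the full language, whereas the chain treats only induction hypotheses of
the fragment. Symbols outside the fragment are interpreted just as the retraction treats them, so
defining formulas may be retracted. -/
theorem holds_fo {J I : PredInterp L c.Dom} (hJ : ∀ P ∉ K.rels, J P = ∅)
    (hI : ∀ P ∉ K.rels, I P = ∅) {k : ℕ} (φ : FO L Ob k) (e : Fin k → c.Dom) :
    FO.Holds c.val J I (K.fo φ) e ↔ FO.Holds c.val J I φ e := by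
  have tm {k : ℕ} (t : Tm L Ob k) (e : Fin k → c.Dom) :
      (K.tm t).realize (Sum.elim c.val e) = t.realize (Sum.elim c.val e) := by
    obtain ⟨s, hs, rfl⟩ := exists_isTm_fun e
    rw [realize_eq_cls, realize_eq_cls, ← cls_tm (t.subst (closing s)),
      Fragment.tm_subst t (closing s) fun _ => rfl]
    congr 3
    funext i
    exact (hs i).symm
  induction φ generalizing J I with
  | ext a => exact a.elim
  | top => exact Iff.rfl
  | bot => exact Iff.rfl
  | eq t s => simp only [Fragment.fo, Fml.Holds, tm]
  | rel R ts =>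
    by_cases hR : (⟨_, R⟩ : Pred L) ∈ K.rels
    · simp only [Fragment.fo, hR, if_true, Fml.Holds, tm]
    · simp only [Fragment.fo, hR, if_false, Fml.Holds, hJ _ hR, Set.mem_empty_iff_false]
  | neg φ ih => exact not_congr (ih hI hJ e)
  | and φ ψ ih ih' => exact and_congr (ih hJ hI e) (ih' hJ hI e)
  | or φ ψ ih ih' => exact or_congr (ih hJ hI e) (ih' hJ hI e)
  | imp φ ψ ih ih' => exact imp_congr (ih hI hJ e) (ih' hJ hI e)
  | iff φ ψ ih ih' =>
    exact and_congr (imp_congr (ih hI hJ e) (ih' hJ hI e)) (imp_congr (ih' hI hJ e) (ih hJ hI e))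
  | all φ ih => exact forall_congr' fun a => ih hJ hI _
  | ex φ ih => exact exists_congr fun a => ih hJ hI _

/-- The interpretation that is full on the predicates of the fragment and empty elsewhere is closed,
because all left atoms and rule heads belong to the fragment. -/
theorem preds_eq_empty (hΦ : ∀ i, ∀ r ∈ Φ i, K.IsRule r) {P : Pred L} (hP : P ∉ K.rels) :
    c.preds P = ∅ := by
  refine Set.eq_empty_of_subset_empty (preds_subset (J := fun P => {_a | P ∈ K.rels})
    ⟨fun Q t h => (Fragment.isFO_rel.1 (isFO_of_left h)).1, ?_⟩ P |>.trans fun a ha => hP ha)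
  rintro i Q a ⟨r, hr, b, hb, -⟩
  cases hb
  exact (hΦ i r hr).pred

/-- The induction rule: atoms on the left side hold in every definable interpretation of the
defined predicates that is closed under the rules. -/
theorem mem_of_rel_left [Infinite Ob] (hΦ : ∀ i, ∀ r ∈ Φ i, K.IsRule r) {i : Fin n}
    {J : PredInterp L c.Dom} (hJ : ∀ P ∉ (Φ i).defined, J P = c.preds P)
    (hdef : ∀ P ∈ (Φ i).defined, J P ∈ c.definable P.1)
    (hop : ∀ P ∈ (Φ i).defined, (Φ i).op c.val Fin.elim0 J c.preds P ⊆ J P)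
    {P : Pred L} (hP : P ∈ (Φ i).defined) {v : Fin P.1 → Tm L Ob 0}
    (hv : .rel P.2 v ∈ c.Left) : (fun j => c.cls (v j)) ∈ J P := by
  choose G hG using hdef
  let F : ∀ Q : (Φ i).defined, FO L Ob Q.1.1 := fun Q => K.fo (G Q.1 Q.2)
  have hF (Q : Pred L) (hQ : Q ∈ (Φ i).defined) (a : Fin Q.1 → c.Dom) :
      a ∈ J Q ↔ FO.Holds c.val c.preds c.preds (extendBot (Φ i) F Q) a := by
    have he (P : Pred L) (hP : P ∉ K.rels) : c.preds P = ∅ := preds_eq_empty hΦ hP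
    simp only [extendBot, hQ, dif_pos, F]
    rw [holds_fo he he, ← hG]
  obtain ⟨m, h | ⟨r, hr, y, hy, hl, hr'⟩ | h⟩ :=
    c.induction i F (fun Q => Fragment.fo_fo _) P hP v (isTm_of_rel_left hv)
  · exact (hF P hP _).2 ((truth_preds hΦ _ v).1 ⟨m, h⟩)
  -- A minor premise in the limit: its left formula says that the rule fires in `J`, its right
  -- formula that the head lies outside `J`, against `hop`.
  · exfalso
    have hrd : r.pred ∈ (Φ i).defined := ⟨r, hr, rfl⟩
    refine (truth_preds hΦ _ _).2 ⟨m, hr'⟩ ((hF r.pred hrd _).1 (hop r.pred hrd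
      ⟨r, hr, fun j => c.cls (ob (y j)), ?_, ?_⟩))
    · refine congrArg (Sigma.mk r.pred) (funext fun j => ?_)
      rw [append_elim0, Sub.inst_eq_closing, realize_eq_cls]
    · have := (truth_sentence hΦ _).1 ⟨m, hl⟩
      rw [minorBody, FO.holds_replace hF hJ, Sub.inst_eq_closing, FO.holds_subst] at this
      rw [append_elim0]
      exact this
  -- The remaining alternative would make the atom on the left refutable by the induction rule.
  · refine (notMem_of_eventually_left (c := c) ?_ hv).elim
    filter_upwards [Filter.eventually_ge_atTop m] with k hk
      using h.mono (Set.insert_subset_insert (c.left_mono hk)) (c.right_mono hk)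

/-- The term model is a Henkin model of the definitions. -/
theorem henkinModel [Infinite Ob] (hΦ : ∀ i, ∀ r ∈ Φ i, K.IsRule r)
    (hC : ∀ i, ∀ r ∈ Φ i, ∀ Q, FO.Occurs Q false r.body → FO.toID (excludedMiddle Q) ∈ C)
    (hdisj : ∀ i j, i ≠ j → (Φ i).defined ∩ (Φ j).defined = ∅) (i : Fin n) :
    @Defn.HenkinModel L Ob c.Dom c.model c.definable c.val 0 (Φ i) Fin.elim0 := by
  have hop (i : Fin n) (J : PredInterp L c.Dom) :
      (Φ i).op c.val Fin.elim0 J c.preds = (Φ i).op c.val Fin.elim0 J c.maxPreds :=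
    Defn.op_congr_right fun r hr Q hQ =>
      preds_eq_maxPreds hΦ (hC i r hr Q hQ) ((hΦ i r hr).occurs Q hQ)
  simp only [Defn.HenkinModel, ofStructure_withPreds, op_withPreds]
  refine ⟨⟨fun _ _ => rfl, fun P _ => ⟨.rel P.2 bv, fun a => Iff.rfl⟩, fun P _ => ?_⟩, ?_⟩
  · rw [hop]
    exact isClosedInterp_preds.op i P
  · rintro J ⟨hJ, hdef, hJop⟩
    -- The intersection is used because `J` itself need not be closed under the other definitions,
    -- while `preds` is.
    have hclosed : c.IsClosedInterp fun P => c.preds P ∩ J P := by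
      refine ⟨fun P v hv => ⟨isClosedInterp_preds.left P v hv, ?_⟩, fun j P a ha => ⟨?_, ?_⟩⟩
      · by_cases hP : P ∈ (Φ i).defined
        · exact mem_of_rel_left hΦ hJ hdef hJop hP hv
        · rw [hJ P hP]
          exact isClosedInterp_preds.left P v hv
      · exact isClosedInterp_preds.op j P (Defn.op_mono (fun _ => Set.inter_subset_left) P ha)
      · by_cases hP : P ∈ (Φ i).defined
        -- A predicate defined in `Φ i` can be the head only of rules of `Φ i`.
        · have hj : i = j := by
            by_contra hij
            obtain ⟨r, hr, b, hb, -⟩ := ha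
            exact (hdisj i j hij).subset ⟨hP, r, hr, congrArg Sigma.fst hb⟩
          subst hj
          refine hJop P hP ?_
          rw [hop]
          exact Defn.op_mono (fun _ => Set.inter_subset_right) P ha
        · rw [hJ P hP]
          exact isClosedInterp_preds.op j P (Defn.op_mono (fun _ => Set.inter_subset_left) P ha)
    exact fun P => (preds_subset hclosed P).trans Set.inter_subset_right

end SaturatedChain

/-! ### Assembly of the countermodel. -/

/-- Henkin completeness with elementary cuts. -/
theorem provable_of_henkinValid {L : FirstOrder.Language.{u, u}} {Ob : Type u} [Infinite Ob]
    {C : Set (FOIDFml L Ob 0)} {Γ Δ : Set (FO L Ob 0)} {n : ℕ} {Φ : Fin n → Defn L Ob 0}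
    (hΓ : Γ.Finite) (hΔ : Δ.Finite)
    (hC : ∀ i, ∀ r ∈ Φ i, ∀ Q, FO.Occurs Q false r.body → FO.toID (excludedMiddle Q) ∈ C)
    (hdisj : ∀ i j, i ≠ j → (Φ i).defined ∩ (Φ j).defined = ∅)
    (hvalid : HenkinValid (antecedent Γ Φ) (succedent Δ)) : Prov C Φ Γ Δ := by
  by_contra hprov
  -- The vocabulary may be uncountable, but finitely many formulas and rules fit into one countable
  -- fragment.
  obtain ⟨K, ⟨⟨hKΓ, hKΔ⟩, hKΦ⟩, ho, ho', hf, hr⟩ := EventuallyFragment.exists_countable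
    (((EventuallyFragment.ball hΓ fun φ _ => eventually_isFO φ).and
      (EventuallyFragment.ball hΔ fun φ _ => eventually_isFO φ)).and
      (EventuallyFragment.all fun i => EventuallyFragment.ball (Φ i).finite_toSet
        fun r _ => eventually_isRule r))
  obtain ⟨c, hl, hr⟩ := exists_saturatedChain (C := C) ho ho' hf hr hKΦ
    ⟨(Γ, Δ), hΓ, hΔ, hKΓ, hKΔ, hprov⟩
  have hsat (φ : FO L Ob 0) : @HenkinSat L Ob c.Dom c.model c.definable c.val (FO.toID φ) ↔
      FO.Holds c.val c.preds c.preds φ Fin.elim0 := by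
    exact (@FO.toID_holds L Ob c.Dom c.model _ _ _ _ _ φ Fin.elim0).trans (holds_withPreds _ _ _ _ _ φ Fin.elim0)
  have hne : Nonempty c.Dom := ⟨c.val K.base⟩
  obtain ⟨χ, ⟨φ, hφ, rfl⟩, hχ⟩ := @hvalid c.Dom c.model hne c.val c.definable
    SaturatedChain.isHenkinClass_definable (by
      rintro _ (⟨φ, hφ, rfl⟩ | ⟨i, rfl⟩)
      · exact (hsat φ).2 ((SaturatedChain.truth_sentence hKΦ φ).1 ⟨0, by rwa [hl]⟩)
      · exact SaturatedChain.henkinModel hKΦ hC hdisj i)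
  exact (SaturatedChain.truth_sentence hKΦ φ).2 ⟨0, by rwa [hr]⟩ ((hsat φ).1 hχ)

end FOID

theorem mainTheorem8 {L : FirstOrder.Language.{u, u}} {Ob : Type u} [Infinite Ob]
    (Γ Δ : Set (FOID.FO L Ob 0)) {n : ℕ} (Φ : Fin n → FOID.Defn L Ob 0)
    (hcan : FOID.IsCanonical Γ Φ Δ) (hstrat : ∀ i, (Φ i).Stratified)
    (hvalid : FOID.HenkinValid (FOID.antecedent Γ Φ) (FOID.succedent Δ)) :
    FOID.ProvableWithElementaryCuts Γ Φ Δ :=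
  FOID.provable_of_henkinValid hcan.finite_left hcan.finite_right
    (fun i r hr Q hQ => ⟨Q, ⟨i, r, hr, hQ⟩, rfl⟩) hcan.disjoint hvalid
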